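/- Let $k\ge 1$ and $n_1,\dots,n_k\ge 1$ be integers, let $B_n$ and $S_n$ denote the open unit ball and the unit sphere of $\mathbb C^n$, and put $\mathcal D=B_{n_1}\times\cdots\times B_{n_k}$ and $\partial\mathcal D=S_{n_1}\times\cdots\times S_{n_k}$ (the distinguished boundary). Let $\Sigma$ be the normalized Lebesgue measure on $\partial\mathcal D$ (the product of the normalized surface measures of the spheres) and $m$ the normalized Lebesgue measure on the unit circle $\mathbb T$. For a function $F$ on $\mathcal D$ and $\zeta\in\partial\mathcal D$, write $F(\zeta)=\lim_{r\to1-}F(r\zeta)$. The Hardy space $H^2=H^2(\mathcal D)$ consists of the holomorphic $f:\mathcal D\to\mathbb C$ with $\|f\|_{H^2}^2=\sup_{0<r<1}\int_{\partial\mathcal D}|f(r\zeta)|^2\,d\Sigma(\zeta)<\infty$; its inner product is $(f,g)_{H^2}=\int_{\partial\mathcal D}f\bar g\,d\Sigma$, computed from the boundary values, which exist $\Sigma$-almost everywhere. A holomorphic function $I:\mathcal D\to\{|w|<1\}$ is called inner if $|I(\zeta)|=1$ for $\Sigma$-almost every $\zeta\in\partial\mathcal D$. For such $I$, let $H^2\ominus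 IH^2=\{f\in H^2:\ (f,Ih)_{H^2}=0\ \text{for all } h\in H^2\}$. Let $I$ be an inner function on $\mathcal D$. (1) For every $\Phi\in L^1(\mathbb T,m)$ the composition $\Phi\circ I$ (defined $\Sigma$-a.e. on $\partial\mathcal D$ through the boundary values of $I$) is $\Sigma$-measurable, and for all $f,g\in H^2\ominus IH^2$ the function $(\Phi\circ I)f\bar g$ is $\Sigma$-integrable with $$\int_{\partial\mathcal D}(\Phi\circ I)\,f\,\bar g\,d\Sigma=\Big(\int_{\mathbb T}\Phi\,dm\Big)(f,g)_{H^2}.$$ (2) In particular, for every Lebesgue measurable $Q\subset\mathbb T$, the set $I^{-1}(Q)=\{\zeta\in\partial\mathcal D: I(\zeta)\in Q\}$ is $\Sigma$-measurable and $$\int_{I^{-1}(Q)}|f|^2\,d\Sigma=m(Q)\,\|f\|_{H^2}^2\qquad\text{for all } f\in H^2\ominus IH^2.$$ -/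

import Mathlib

open MeasureTheory Set Filter Topology
open scoped ENNReal ComplexConjugate

noncomputable section

namespace HardyProduct

/-- The ambient space `ℂ^{n₁} × ⋯ × ℂ^{n_k}`, each factor with its Euclidean norm. -/
abbrev Space {k : ℕ} (n : Fin k → ℕ) : Type := (j : Fin k) → EuclideanSpace ℂ (Fin (n j))

/-- The domain `𝓓 = B_{n₁} × ⋯ × B_{n_k}`, a product of open unit balls. -/
def domain {k : ℕ} (n : Fin k → ℕ) : Set (Space n) :=
  {z | ∀ j, ‖z j‖ < 1}

/-- The distinguished boundary `∂𝓓 = S_{n₁} × ⋯ × S_{n_k}`, a product of unit spheres. -/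
abbrev Boundary {k : ℕ} (n : Fin k → ℕ) : Type :=
  (j : Fin k) → Metric.sphere (0 : EuclideanSpace ℂ (Fin (n j))) 1

/-- The point `r ζ` for `ζ ∈ ∂𝓓` and a real number `r`. -/
def dilate {k : ℕ} {n : Fin k → ℕ} (r : ℝ) (ζ : Boundary n) : Space n :=
  fun j => r • (ζ j : EuclideanSpace ℂ (Fin (n j)))

/-- Normalized Lebesgue (surface) measure on the unit sphere of `ℂⁿ`. -/
def sphereMeasure (n : ℕ) : Measure (Metric.sphere (0 : EuclideanSpace ℂ (Fin n)) 1) :=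
  ((volume : Measure (EuclideanSpace ℂ (Fin n))).toSphere univ)⁻¹ •
    (volume : Measure (EuclideanSpace ℂ (Fin n))).toSphere

/-- Normalized Lebesgue measure `Σ` on the distinguished boundary. -/
def boundaryMeasure {k : ℕ} (n : Fin k → ℕ) : Measure (Boundary n) :=
  Measure.pi fun j => sphereMeasure (n j)

/-- The circle carries its Borel `σ`-algebra. -/
instance instMeasurableSpaceCircle : MeasurableSpace Circle := borel Circle

instance instBorelSpaceCircle : BorelSpace Circle := ⟨rfl⟩

/-- Normalized Lebesgue (arc length) measure `m` on the unit circle `𝕋`. -/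
def circleMeasure : Measure Circle :=
  (ENNReal.ofReal (2 * Real.pi))⁻¹ •
    (volume.restrict (Ioc (0 : ℝ) (2 * Real.pi))).map Circle.exp

/-- The radial boundary value `F(ζ) = lim_{r → 1-} F(r ζ)` (a junk value where there is none). -/
def radialLimit {k : ℕ} {n : Fin k → ℕ} (F : Space n → ℂ) (ζ : Boundary n) : ℂ :=
  limUnder (𝓝[<] (1 : ℝ)) fun r : ℝ => F (dilate r ζ)

/-- Inner functions: holomorphic maps from `𝓓` to the open unit disk whose radial limit exists and
is unimodular at almost every point of the distinguished boundary. -/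
def IsInner {k : ℕ} {n : Fin k → ℕ} (I : Space n → ℂ) : Prop :=
  DifferentiableOn ℂ I (domain n) ∧
  (∀ z ∈ domain n, ‖I z‖ < 1) ∧
  ∀ᵐ ζ ∂(boundaryMeasure n), ∃ w : ℂ, ‖w‖ = 1 ∧
    Tendsto (fun r : ℝ => I (dilate r ζ)) (𝓝[<] 1) (𝓝 w)

/-- `‖f‖²` in the Hardy space: `sup_{0<r<1} ∫ |f(rζ)|² dΣ(ζ)`, with values in `[0, ∞]`. -/
def hardyNormSq {k : ℕ} {n : Fin k → ℕ} (f : Space n → ℂ) : ℝ≥0∞ :=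
  ⨆ r ∈ Ioo (0 : ℝ) 1, ∫⁻ ζ, ‖f (dilate r ζ)‖ₑ ^ 2 ∂(boundaryMeasure n)

/-- Membership in the Hardy space `H²(𝓓)`; only the values of `f` on `𝓓` matter. -/
def MemHardy {k : ℕ} {n : Fin k → ℕ} (f : Space n → ℂ) : Prop :=
  DifferentiableOn ℂ f (domain n) ∧ hardyNormSq f < ⊤

/-- The inner product of `H²(𝓓)`, linear in the first variable, computed from boundary values. -/
def hardyInner {k : ℕ} {n : Fin k → ℕ} (f g : Space n → ℂ) : ℂ :=
  ∫ ζ, radialLimit f ζ * conj (radialLimit g ζ) ∂(boundaryMeasure n)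

/-- Membership in the large model space `H² ⊖ I H²`. -/
def MemLargeModel {k : ℕ} {n : Fin k → ℕ} (I f : Space n → ℂ) : Prop :=
  MemHardy f ∧ ∀ h : Space n → ℂ, MemHardy h → hardyInner f (fun z => I z * h z) = 0

/-- The composition `Φ ∘ I` on `∂𝓓`, through the boundary values of `I`; it is set to `0` where
the boundary value of `I` is not on the unit circle (a null set if `I` is inner). -/
def boundaryComp {k : ℕ} {n : Fin k → ℕ} (Φ : Circle → ℂ) (I : Space n → ℂ)
    (ζ : Boundary n) : ℂ :=
  Function.extend ((↑) : Circle → ℂ) Φ 0 (radialLimit I ζ)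

/-- The set `I⁻¹(Q) = {ζ ∈ ∂𝓓 : I(ζ) ∈ Q}` for `Q ⊆ 𝕋`. -/
def boundaryPreimage {k : ℕ} {n : Fin k → ℕ} (I : Space n → ℂ) (Q : Set Circle) :
    Set (Boundary n) :=
  {ζ | ∃ q ∈ Q, radialLimit I ζ = (q : ℂ)}

end HardyProduct

end

/-!
Write `f*` for the radial boundary values of `f`. For `f` in `H² ⊖ I H²` and `m ≥ 0`, the function
`Iᵐ f` is again in `H²`, so `f` is orthogonal to `I · Iᵐ f`, that is, `∫ (I*)ᵐ⁺¹ |f*|² dΣ = 0`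
(`MemLargeModel.moment_eq_zero`). All Fourier coefficients of the image of the measure `|f*|² Σ`
under `I*`, except the one of order zero, therefore vanish, and by uniqueness of Fourier
coefficients this image is `‖f‖² m` (`MemLargeModel.map_withDensity`). This is the assertion on
`|f|²`, and the one on `f ḡ` follows by polarization (`MemLargeModel.integral_comp_mul`). Since `Φ`
is a Borel function only up to a null set, measurability of `Φ ∘ I*` also needs that the image of
`Σ` itself under `I*` is absolutely continuous. This follows from the same identity for the
reproducing kernel `1 - conj (I 0) I` of the model space at the origin, which is bounded away from
zero (`IsInner.quasiMeasurePreserving`).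

The analytic input on `H²` is that radial limits exist almost everywhere, that `∫ |f*|² dΣ = ‖f‖²`,
and that `∫ f* dΣ = f 0`. All three are reduced to the unit disk: `Σ` is invariant under `ζ ↦ c ζ`
for `c` in the circle, so by Fubini's theorem almost every slice `w ↦ f (w ζ)` is in the Hardy space
of the disk, and the statements for the slices integrate to those for `f` (`ae_slice_boundary`).

On the disk, the square-summable Taylor coefficients of `F` are the Fourier coefficients of a
function `u` in `L²` of the circle, and `F` is the Poisson integral of `u`
(`exists_boundary_function`). Poisson integrals converge radially at every Lebesgue point
(`ae_tendsto_integral_poissonKernel_sub`): the Poisson kernel is at most a constant times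
`h / (h² + t²)` with `h = 1 - r`, and the integral of this function against a measure is controlled,
through its distribution function, by the masses of the intervals centred at the given point.
-/

noncomputable section

namespace HardyProduct

/-! ### Normalized arc length on the circle and Fourier uniqueness -/

instance instFactTwoPiPos : Fact (0 < 2 * Real.pi) := ⟨Real.two_pi_pos⟩

/-- The homeomorphism `θ ↦ exp (i θ)` from `ℝ / 2πℤ` carries normalized Haar measure to normalized
arc length. -/
theorem measurePreserving_homeomorphCircle' :
    MeasurePreserving AddCircle.homeomorphCircle'
      (AddCircle.haarAddCircle (T := 2 * Real.pi)) circleMeasure := by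
  refine ⟨AddCircle.homeomorphCircle'.continuous.measurable, ?_⟩
  have h1 := (AddCircle.measurePreserving_mk (2 * Real.pi) 0).map_eq
  rw [zero_add] at h1
  have h2 : (AddCircle.haarAddCircle (T := 2 * Real.pi)) = (ENNReal.ofReal (2 * Real.pi))⁻¹ •
      (volume : Measure (AddCircle (2 * Real.pi))) := by
    rw [AddCircle.volume_eq_smul_haarAddCircle, smul_smul, ENNReal.inv_mul_cancel, one_smul]
    · simp [Real.pi_pos]
    · exact ENNReal.ofReal_ne_top
  rw [h2, ← h1, Measure.map_smul, Measure.map_map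
    AddCircle.homeomorphCircle'.continuous.measurable (AddCircle.measurable_mk' )]
  rfl

instance instIsProbabilityMeasureCircle : IsProbabilityMeasure circleMeasure :=
  measurePreserving_homeomorphCircle'.map_eq ▸ Measure.isProbabilityMeasure_map
    AddCircle.homeomorphCircle'.continuous.aemeasurable

theorem integral_circleMeasure {E : Type*} [NormedAddCommGroup E] [NormedSpace ℝ E]
    (g : Circle → E) :
    ∫ c, g c ∂circleMeasure = (2 * Real.pi)⁻¹ • ∫ θ in (0 : ℝ)..2 * Real.pi, g (Circle.exp θ) := by
  rw [← measurePreserving_homeomorphCircle'.integral_comp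
    AddCircle.homeomorphCircle'.measurableEmbedding, AddCircle.integral_haarAddCircle,
    ← AddCircle.intervalIntegral_preimage (2 * Real.pi) 0, zero_add]
  rfl

theorem fourier_eq_zpow (n : ℤ) (x : AddCircle (2 * Real.pi)) :
    fourier n x = (AddCircle.homeomorphCircle' x : ℂ) ^ n := by
  have h : AddCircle.toCircle x = AddCircle.homeomorphCircle' x := by
    induction x using QuotientAddGroup.induction_on with
    | H x =>
      rw [AddCircle.homeomorphCircle'_apply_mk, AddCircle.toCircle_apply_mk,
        div_self Real.two_pi_pos.ne', one_mul]
  rw [fourier_apply, AddCircle.toCircle_zsmul, h]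
  simp

theorem integral_zpow (n : ℤ) :
    ∫ c : Circle, (c : ℂ) ^ n ∂circleMeasure = if n = 0 then 1 else 0 := by
  rw [← measurePreserving_homeomorphCircle'.integral_comp
    AddCircle.homeomorphCircle'.measurableEmbedding]
  have h := congrFun (fourierCoeff_fourier (T := 2 * Real.pi) n) 0
  simp only [fourierCoeff, neg_zero, fourier_zero, one_smul, Pi.single_apply] at h
  simp only [← fourier_eq_zpow, h, eq_comm]

/-- A finite measure on the circle is determined by its Fourier coefficients. -/
theorem circle_measure_ext {μ ν : Measure Circle} [IsFiniteMeasure μ] [IsFiniteMeasure ν]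
    (h : ∀ n : ℤ, ∫ c : Circle, (c : ℂ) ^ n ∂μ = ∫ c : Circle, (c : ℂ) ^ n ∂ν) : μ = ν := by
  set e := AddCircle.homeomorphCircle'.symm
  have hint : ∀ (κ : Measure Circle) [IsFiniteMeasure κ] (g : C(AddCircle (2 * Real.pi), ℂ)),
      Integrable (fun c => g (e c)) κ := fun κ _ g =>
    (BoundedContinuousFunction.mkOfCompact (g.comp ⟨e, e.continuous⟩)).integrable κ
  have key : ∀ g : C(AddCircle (2 * Real.pi), ℂ), ∫ c, g (e c) ∂μ = ∫ c, g (e c) ∂ν := by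
    intro g
    have hg : g ∈ (Submodule.span ℂ (range <| @fourier (2 * Real.pi))).topologicalClosure := by
      rw [span_fourier_closure_eq_top]; trivial
    rw [← SetLike.mem_coe, Submodule.topologicalClosure_coe] at hg
    have hcont : ∀ (κ : Measure Circle) [IsFiniteMeasure κ],
        Continuous fun g : C(AddCircle (2 * Real.pi), ℂ) => ∫ c, g (e c) ∂κ := by
      intro κ _
      refine continuous_iff_continuousAt.2 fun g₀ => ?_
      refine tendsto_integral_filter_of_dominated_convergence (fun _ => ‖g₀‖ + 1) ?_ ?_ ?_ ?_
      · exact Eventually.of_forall fun g => (hint κ g).aestronglyMeasurable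
      · have : ∀ᶠ g in 𝓝 g₀, ‖g‖ < ‖g₀‖ + 1 :=
          continuous_norm.continuousAt.eventually (gt_mem_nhds (lt_add_one _))
        filter_upwards [this] with g hg
        exact Eventually.of_forall fun c => (g.norm_coe_le_norm _).trans hg.le
      · exact integrable_const _
      · exact Eventually.of_forall fun c => (continuous_eval_const (e c)).continuousAt
    refine closure_minimal (t := {g : C(AddCircle (2 * Real.pi), ℂ) |
      ∫ c, g (e c) ∂μ = ∫ c, g (e c) ∂ν}) ?_ (isClosed_eq (hcont μ) (hcont ν)) hg
    intro g hg
    induction hg using Submodule.span_induction with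
    | mem g hg =>
      obtain ⟨n, rfl⟩ := hg
      simpa only [mem_ofPred_eq, fourier_eq_zpow, e, Homeomorph.apply_symm_apply] using h n
    | zero => simp
    | add f g _ _ hf hg =>
      simp only [mem_ofPred_eq, ContinuousMap.add_apply] at *
      rw [integral_add (hint μ f) (hint μ g), integral_add (hint ν f) (hint ν g), hf, hg]
    | smul a g _ hg =>
      simp only [mem_ofPred_eq, ContinuousMap.smul_apply] at *
      rw [integral_smul, integral_smul, hg]
  refine ext_of_forall_integral_eq_of_IsFiniteMeasure fun f => ?_
  have := key ⟨fun x => ((f (e.symm x) : ℝ) : ℂ), by fun_prop⟩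
  simp only [ContinuousMap.coe_mk, Homeomorph.symm_apply_apply, integral_complex_ofReal] at this
  exact_mod_cast this

/-- A finite measure on the circle whose Fourier coefficients of positive order vanish is a multiple
of normalized arc length: the coefficients of negative order are the conjugates. -/
theorem eq_smul_circleMeasure {ν : Measure Circle} [IsFiniteMeasure ν]
    (h : ∀ n : ℕ, ∫ c : Circle, (c : ℂ) ^ (n + 1) ∂ν = 0) : ν = ν univ • circleMeasure := by
  have : IsFiniteMeasure (ν univ • circleMeasure) :=
    Measure.smul_finite _ (measure_ne_top ν univ)
  refine circle_measure_ext fun n => ?_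
  rw [integral_smul_measure, integral_zpow]
  rcases lt_trichotomy n 0 with hn | rfl | hn
  · obtain ⟨m, rfl⟩ : ∃ m : ℕ, n = -((m : ℤ) + 1) := ⟨(-n - 1).toNat, by omega⟩
    have h1 : ∀ c : Circle, (c : ℂ) ^ (-((m : ℤ) + 1)) = conj ((c : ℂ) ^ (m + 1)) := by
      intro c
      rw [map_pow, ← Circle.coe_inv_eq_conj, zpow_neg, Circle.coe_inv, inv_pow]
      norm_cast
    simp only [h1, integral_conj, h m]
    rw [if_neg hn.ne]; simp
  · simp [measureReal_def]
  · obtain ⟨m, rfl⟩ : ∃ m : ℕ, n = (m : ℤ) + 1 := ⟨(n - 1).toNat, by omega⟩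
    have h1 : ∀ c : Circle, (c : ℂ) ^ ((m : ℤ) + 1) = (c : ℂ) ^ (m + 1) := fun c => by norm_cast
    rw [if_neg hn.ne']
    simp only [h1, h m, smul_zero]

/-! ### Poisson integrals at Lebesgue points -/

/-- A layer-cake estimate: if a measure gives mass at most `ε s` to the closed interval of radius
`s` around `x` for small `s`, its integral against `h / (h² + (t - x)²)` is at most `2 ε`, up to a
term that tends to `0` with `h`. -/
theorem lintegral_poissonBound_le (μ : Measure ℝ) (x : ℝ) {ε δ h : ℝ} (hε : 0 ≤ ε) (hδ : 0 < δ)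
    (hh : 0 < h)
    (H : ∀ s, 0 < s → s ≤ δ → μ (Metric.closedBall x s) ≤ ENNReal.ofReal (ε * s)) :
    ∫⁻ t, ENNReal.ofReal (h / (h ^ 2 + (t - x) ^ 2)) ∂μ ≤
      ENNReal.ofReal (2 * ε) + μ univ * ENNReal.ofReal (h / δ ^ 2) := by
  rw [lintegral_eq_lintegral_meas_lt μ (Eventually.of_forall fun t => by positivity)
    (by fun_prop)]
  -- The set where the kernel exceeds `y` is empty for `y > 1 / h` and otherwise lies in the
  -- interval of radius `√(h / y)`, which is at most `δ` unless `y ≤ h / δ²`.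
  have hpt : ∀ y ∈ Ioi (0 : ℝ), μ {t | y < h / (h ^ 2 + (t - x) ^ 2)} ≤
      (Ioc 0 (1 / h)).indicator
        (fun y => ENNReal.ofReal (ε * Real.sqrt h * y ^ (-(1 / 2) : ℝ))) y +
      (Ioc 0 (h / δ ^ 2)).indicator (fun _ => μ univ) y := by
    intro y (hy : 0 < y)
    by_cases hy1 : 1 / h < y
    · have : {t | y < h / (h ^ 2 + (t - x) ^ 2)} = ∅ := by
        refine eq_empty_of_forall_notMem fun t (ht : y < _) => ?_
        have : h / (h ^ 2 + (t - x) ^ 2) ≤ 1 / h := by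
          rw [div_le_div_iff₀ (by positivity) hh]
          nlinarith [sq_nonneg (t - x)]
        linarith
      simp [this]
    by_cases hy2 : y ≤ h / δ ^ 2
    · rw [indicator_of_mem (s := Ioc 0 (h / δ ^ 2)) ⟨hy, hy2⟩]
      exact (measure_mono (subset_univ _)).trans le_add_self
    · rw [indicator_of_mem (s := Ioc 0 (1 / h)) ⟨hy, not_lt.1 hy1⟩]
      have hs : Real.sqrt (h / y) ≤ δ := by
        rw [Real.sqrt_le_left hδ.le, div_le_iff₀ hy, ← div_le_iff₀' (by positivity)]
        exact (not_le.1 hy2).le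
      refine le_add_right ((measure_mono ?_).trans ((H _ (by positivity) hs).trans_eq ?_))
      · intro t (ht : y < _)
        rw [Metric.mem_closedBall, Real.dist_eq]
        refine Real.abs_le_sqrt ?_
        rw [lt_div_iff₀ (by positivity)] at ht
        rw [le_div_iff₀ hy]
        nlinarith [sq_nonneg h]
      · rw [Real.sqrt_div hh.le, Real.rpow_neg hy.le, ← Real.sqrt_eq_rpow, div_eq_mul_inv,
          mul_assoc]
  refine (setLIntegral_mono' measurableSet_Ioi hpt).trans ?_
  refine (setLIntegral_le_lintegral _ _).trans ?_
  rw [lintegral_add_left (Measurable.indicator (by fun_prop) measurableSet_Ioc),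
    lintegral_indicator measurableSet_Ioc, lintegral_indicator measurableSet_Ioc,
    setLIntegral_const, Real.volume_Ioc, sub_zero]
  gcongr
  have hint : IntervalIntegrable (fun y : ℝ => ε * Real.sqrt h * y ^ (-(1 / 2) : ℝ)) volume
      0 (1 / h) := (intervalIntegral.intervalIntegrable_rpow' (by norm_num)).const_mul _
  rw [intervalIntegrable_iff_integrableOn_Ioc_of_le (by positivity)] at hint
  rw [← ofReal_integral_eq_lintegral_ofReal hint]
  · rw [← intervalIntegral.integral_of_le (by positivity), intervalIntegral.integral_const_mul,
      integral_rpow (Or.inl (by norm_num))]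
    have : (-(1 / 2) + 1 : ℝ) = 1 / 2 := by norm_num
    rw [this, Real.zero_rpow (by norm_num), ← Real.sqrt_eq_rpow, one_div h, Real.sqrt_inv]
    refine ENNReal.ofReal_le_ofReal (le_of_eq ?_)
    have : Real.sqrt h ≠ 0 := (Real.sqrt_pos.2 hh).ne'
    field_simp
    ring
  · filter_upwards [ae_restrict_mem measurableSet_Ioc] with y hy
    exact mul_nonneg (by positivity) (Real.rpow_nonneg hy.1.le _)

theorem norm_exp_sub_sq (r t x : ℝ) :
    ‖(Circle.exp t : ℂ) - r * Circle.exp x‖ ^ 2 =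
      (1 - r) ^ 2 + 2 * r * (1 - Real.cos (t - x)) := by
  rw [← Complex.normSq_eq_norm_sq, Complex.normSq_apply, Real.cos_sub]
  simp only [Circle.coe_exp, Complex.sub_re, Complex.sub_im, Complex.exp_ofReal_mul_I_re,
    Complex.exp_ofReal_mul_I_im, Complex.re_ofReal_mul, Complex.im_ofReal_mul]
  have h1 := Real.sin_sq_add_cos_sq t
  have h2 := Real.sin_sq_add_cos_sq x
  linear_combination h1 + r ^ 2 * h2

theorem poissonKernel_nonneg {r : ℝ} (hr : 0 ≤ r) (hr1 : r < 1) (c z : Circle) :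
    0 ≤ poissonKernel 0 (r * c) z := by
  rw [poissonKernel_def]
  simp only [sub_zero, Circle.norm_coe, norm_mul, Complex.norm_real, Real.norm_eq_abs, mul_one,
    sq_abs]
  exact div_nonneg (by nlinarith) (by positivity)

/-- The Poisson kernel is dominated by `h / (h² + s²)`, where `h = 1 - r` and `s` is the difference
of the angles. -/
theorem poissonKernel_le {r t x : ℝ} (hr : 1 / 2 ≤ r) (hr1 : r < 1) (ht : |t - x| ≤ Real.pi) :
    poissonKernel 0 (r * Circle.exp x) (Circle.exp t) ≤
      16 * ((1 - r) / ((1 - r) ^ 2 + (t - x) ^ 2)) := by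
  rw [poissonKernel_def]
  simp only [sub_zero, norm_exp_sub_sq]
  simp only [Circle.norm_coe, norm_mul, Complex.norm_real, Real.norm_eq_abs, mul_one, sq_abs]
  have hcos := Real.cos_le_one_sub_mul_cos_sq ht
  have hpi : (1 : ℝ) / 8 ≤ 2 / Real.pi ^ 2 := by
    rw [div_le_div_iff₀ (by norm_num) (by positivity)]
    nlinarith [Real.pi_lt_four, Real.pi_pos]
  have h1 : 1 / 8 * (t - x) ^ 2 ≤ 1 - Real.cos (t - x) :=
    (mul_le_mul_of_nonneg_right hpi (sq_nonneg _)).trans (by linarith)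
  have h2 : 0 < 1 - r := by linarith
  rw [← mul_div_assoc, div_le_div_iff₀ (by nlinarith [sq_nonneg (t - x)]) (by positivity)]
  have h3 : ((1 - r) ^ 2 + (t - x) ^ 2) / 8 ≤ (1 - r) ^ 2 + 2 * r * (1 - Real.cos (t - x)) := by
    nlinarith [sq_nonneg (t - x), sq_nonneg (1 - r)]
  have h4 : (1 ^ 2 - r ^ 2) ≤ 2 * (1 - r) := by nlinarith
  calc (1 ^ 2 - r ^ 2) * ((1 - r) ^ 2 + (t - x) ^ 2)
      ≤ 2 * (1 - r) * ((1 - r) ^ 2 + (t - x) ^ 2) := by gcongr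
    _ ≤ 16 * (1 - r) * ((1 - r) ^ 2 + 2 * r * (1 - Real.cos (t - x))) := by nlinarith

/-- At a Lebesgue point `x` of `u`, the Poisson integrals of `u - u x` over one period tend to `0`
along the radius that ends at `exp (i x)`. -/
theorem ae_tendsto_integral_poissonKernel_sub {u : ℝ → ℂ} (hu : LocallyIntegrable u) :
    ∀ᵐ x, Tendsto (fun r : ℝ => ∫ t in Ioc (x - Real.pi) (x + Real.pi),
      poissonKernel 0 (r * Circle.exp x) (Circle.exp t) • (u t - u x)) (𝓝[<] 1) (𝓝 0) := by
  filter_upwards [(IsUnifLocDoublingMeasure.vitaliFamily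
    volume 1).ae_tendsto_lintegral_enorm_sub_div hu] with x hx
  have hball : Tendsto (fun s : ℝ => (∫⁻ y in Metric.closedBall x s, ‖u y - u x‖ₑ) /
      volume (Metric.closedBall x s)) (𝓝[>] 0) (𝓝 0) :=
    hx.comp (IsUnifLocDoublingMeasure.tendsto_closedBall_filterAt volume (fun _ => x) (fun s => s)
      tendsto_id (by filter_upwards [self_mem_nhdsWithin] with s (hs : 0 < s); simpa using hs.le))
  set J := Ioc (x - Real.pi) (x + Real.pi) with hJ
  set μ : Measure ℝ := (volume.restrict J).withDensity fun t => ‖u t - u x‖ₑ with hμ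
  have hfin : μ univ ≠ ∞ := by
    rw [hμ, withDensity_apply _ MeasurableSet.univ, Measure.restrict_univ]
    have h1 : IntegrableOn u J := (hu.integrableOn_isCompact
      (isCompact_Icc (a := x - Real.pi) (b := x + Real.pi))).mono_set Ioc_subset_Icc_self
    have h2 : IntegrableOn (fun t => u t - u x) J := h1.sub (integrableOn_const (by simp [J]))
    exact h2.2.ne
  have hae : AEMeasurable (fun t => ‖u t - u x‖ₑ) (volume.restrict J) :=
    ((hu.aestronglyMeasurable.aemeasurable.sub_const _).enorm).restrict
  have hsmall : ∀ ε : ℝ, 0 < ε → ∃ δ : ℝ, 0 < δ ∧ ∀ s, 0 < s → s ≤ δ →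
      μ (Metric.closedBall x s) ≤ ENNReal.ofReal (ε * s) := by
    intro ε hε
    have h1 : ∀ᶠ s in 𝓝[>] (0 : ℝ), (∫⁻ y in Metric.closedBall x s, ‖u y - u x‖ₑ) /
      volume (Metric.closedBall x s) < ENNReal.ofReal (ε / 2) :=
      hball.eventually (gt_mem_nhds (by simpa using hε))
    obtain ⟨δ, hδ, h2⟩ := mem_nhdsGT_iff_exists_Ioc_subset.1 h1
    refine ⟨δ, hδ, fun s hs hsδ => ?_⟩
    have h3 := (mem_ofPred_eq.mp (h2 ⟨hs, hsδ⟩)).le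
    rw [Real.volume_closedBall, ENNReal.div_le_iff (by simpa using hs) ENNReal.ofReal_ne_top,
      ← ENNReal.ofReal_mul (by positivity)] at h3
    rw [hμ, withDensity_apply _ Metric.isClosed_closedBall.measurableSet]
    refine le_trans (lintegral_mono' (Measure.restrict_mono_measure Measure.restrict_le_self _)
      le_rfl) (h3.trans_eq ?_)
    congr 1; ring
  rw [tendsto_zero_iff_enorm_tendsto_zero, ENNReal.tendsto_nhds_zero]
  intro η hη
  obtain ⟨ε, hε, hεη⟩ : ∃ ε : ℝ, 0 < ε ∧ ENNReal.ofReal (16 * (2 * ε)) ≤ η / 2 := by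
    have h0 : 0 < min η 1 := by simp [hη]
    have htop : min η 1 ≠ ∞ := by simp
    refine ⟨(min η 1).toReal / 64, by have := ENNReal.toReal_pos h0.ne' htop; positivity, ?_⟩
    rw [show 16 * (2 * ((min η 1).toReal / 64)) = (min η 1).toReal / 2 by ring,
      ENNReal.ofReal_div_of_pos (by norm_num), ENNReal.ofReal_toReal htop]
    simp only [ENNReal.ofReal_ofNat]
    gcongr
    exact min_le_left _ _
  obtain ⟨δ, hδ, hs⟩ := hsmall ε hε
  have hlim : Tendsto (fun r : ℝ => 16 * (μ univ * ENNReal.ofReal ((1 - r) / δ ^ 2))) (𝓝[<] 1)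
      (𝓝 0) := by
    have h1 : Tendsto (fun r : ℝ => ENNReal.ofReal ((1 - r) / δ ^ 2)) (𝓝[<] 1) (𝓝 0) := by
      have : Continuous fun r : ℝ => ENNReal.ofReal ((1 - r) / δ ^ 2) :=
        ENNReal.continuous_ofReal.comp (by fun_prop)
      have := (this.tendsto 1).mono_left (nhdsWithin_le_nhds (s := Iio 1))
      simpa using this
    have h2 := ENNReal.Tendsto.const_mul (a := 16) (ENNReal.Tendsto.const_mul h1 (Or.inr hfin))
      (Or.inr (by simp))
    simpa using h2
  have hIoo : Ioo (1 / 2 : ℝ) 1 ∈ 𝓝[<] (1 : ℝ) := Ioo_mem_nhdsLT (by norm_num)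
  filter_upwards [hIoo, hlim.eventually (ge_mem_nhds (ENNReal.half_pos hη.ne'))]
    with r hr hrη
  calc ‖∫ t in J, poissonKernel 0 (r * Circle.exp x) (Circle.exp t) • (u t - u x)‖ₑ
      ≤ ∫⁻ t in J, ‖poissonKernel 0 (r * Circle.exp x) (Circle.exp t) • (u t - u x)‖ₑ :=
        enorm_integral_le_lintegral_enorm _
    _ ≤ ∫⁻ t in J, ‖u t - u x‖ₑ *
          ENNReal.ofReal (16 * ((1 - r) / ((1 - r) ^ 2 + (t - x) ^ 2))) := by
        refine setLIntegral_mono' measurableSet_Ioc fun t ht => ?_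
        rw [enorm_smul, mul_comm]
        gcongr
        rw [Real.enorm_of_nonneg (poissonKernel_nonneg (by linarith [hr.1]) hr.2 _ _)]
        refine ENNReal.ofReal_le_ofReal (poissonKernel_le hr.1.le hr.2 ?_)
        rw [abs_le]; constructor <;> linarith [ht.1, ht.2]
    _ = 16 * ∫⁻ t, ENNReal.ofReal ((1 - r) / ((1 - r) ^ 2 + (t - x) ^ 2)) ∂μ := by
        rw [hμ, lintegral_withDensity_eq_lintegral_mul₀ hae (by fun_prop),
          ← lintegral_const_mul'' _ (by fun_prop)]
        refine lintegral_congr fun t => ?_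
        rw [ENNReal.ofReal_mul (by norm_num), Pi.mul_apply]
        simp only [ENNReal.ofReal_ofNat]
        ring
    _ ≤ 16 * (ENNReal.ofReal (2 * ε) + μ univ * ENNReal.ofReal ((1 - r) / δ ^ 2)) := by
        gcongr
        exact lintegral_poissonBound_le μ x hε.le hδ (by linarith [hr.2]) hs
    _ ≤ η := by
        rw [mul_add, ← ENNReal.add_halves η]
        gcongr
        rw [ENNReal.ofReal_mul (by norm_num)] at hεη
        simpa using hεη

/-! ### Boundary functions from square-summable power series -/

/-- An almost-everywhere statement in the angle gives one on the circle. No measurability of `p` is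
needed, since the parametrization of the circle by a half-open period is a Borel embedding. -/
theorem ae_circleMeasure_of_ae {p : Circle → Prop} (h : ∀ᵐ x : ℝ, p (Circle.exp x)) :
    ∀ᵐ c ∂circleMeasure, p c := by
  have : StandardBorelSpace (Ioc (0 : ℝ) (2 * Real.pi)) := measurableSet_Ioc.standardBorel
  have hemb : MeasurableEmbedding fun x : Ioc (0 : ℝ) (2 * Real.pi) => Circle.exp x := by
    refine Measurable.measurableEmbedding
      (Circle.exp.continuous.measurable.comp measurable_subtype_coe) fun x y hxy => ?_
    have h1 := x.2.1; have h2 := x.2.2; have h3 := y.2.1; have h4 := y.2.2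
    obtain ⟨m, hm⟩ := Circle.exp_eq_exp.1 hxy
    have hm0 : m = 0 := by
      have hpi := Real.two_pi_pos
      have h5 : (m : ℝ) < 1 := by
        by_contra hcon
        nlinarith
      have h6 : (-1 : ℝ) < m := by
        by_contra hcon
        nlinarith
      have h7 : m < 1 := by exact_mod_cast h5
      have h8 : -1 < m := by exact_mod_cast h6
      omega
    subst hm0
    exact Subtype.ext (by simpa using hm)
  have hmap : (volume.restrict (Ioc (0 : ℝ) (2 * Real.pi))).map Circle.exp =
      (volume.comap ((↑) : Ioc (0 : ℝ) (2 * Real.pi) → ℝ)).map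
        fun x : Ioc (0 : ℝ) (2 * Real.pi) => Circle.exp x := by
    rw [← map_comap_subtype_coe measurableSet_Ioc, Measure.map_map
      Circle.exp.continuous.measurable measurable_subtype_coe]
    rfl
  have hval := MeasurableEmbedding.subtype_coe (measurableSet_Ioc (a := (0 : ℝ)) (b := 2 * Real.pi))
  refine Measure.ae_smul_measure ?_ _
  rw [hmap, hemb.ae_map_iff]
  exact hval.ae_map_iff.1
    (by rw [map_comap_subtype_coe measurableSet_Ioc]; exact ae_restrict_of_ae h)

theorem continuous_poissonKernel {w : ℂ} (hw : ‖w‖ < 1) :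
    Continuous fun c : Circle => poissonKernel 0 w c := by
  simp only [poissonKernel_def, sub_zero]
  refine Continuous.div (by fun_prop) (by fun_prop) fun c hc => ?_
  have : (c : ℂ) = w := by simpa [sub_eq_zero] using hc
  rw [← this, Circle.norm_coe] at hw
  exact lt_irrefl _ hw

/-- Poisson integrals reproduce the monomials. -/
theorem integral_poissonKernel_pow {w : ℂ} (hw : ‖w‖ < 1) (n : ℕ) :
    ∫ c : Circle, poissonKernel 0 w c • (c : ℂ) ^ n ∂circleMeasure = w ^ n := by
  have h := DiffContOnCl.circleAverage_poissonKernel_smul (f := fun z : ℂ => z ^ n) (c := 0)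
    (R := 1) (w := w) (Differentiable.diffContOnCl (by fun_prop)) (by simpa using hw)
  rw [← h, integral_circleMeasure, Real.circleAverage_def]
  simp [circleMap]

theorem integrable_poissonKernel_smul {u : Circle → ℂ} (hu : Integrable u circleMeasure) {w : ℂ}
    (hw : ‖w‖ < 1) : Integrable (fun c : Circle => poissonKernel 0 w c • u c) circleMeasure := by
  have hc := continuous_poissonKernel hw
  obtain ⟨C, hC⟩ := (isCompact_range hc).isBounded.exists_norm_le
  exact hu.bdd_smul C hc.aestronglyMeasurable
    (Eventually.of_forall fun c => hC _ (mem_range_self c))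

/-- Poisson integrals of an integrable function converge radially to it almost everywhere. -/
theorem ae_tendsto_integral_poissonKernel {u : Circle → ℂ} (hu : Integrable u circleMeasure) :
    ∀ᵐ c : Circle ∂circleMeasure, Tendsto
      (fun r : ℝ => ∫ z : Circle, poissonKernel 0 (r * c) z • u z ∂circleMeasure)
      (𝓝[<] 1) (𝓝 (u c)) := by
  have hper : Function.Periodic (fun t : ℝ => u (Circle.exp t)) (2 * Real.pi) := fun t => by
    simp only [Circle.periodic_exp t]
  have hint : IntervalIntegrable (fun t : ℝ => u (Circle.exp t)) volume 0 (2 * Real.pi) := by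
    rw [intervalIntegrable_iff_integrableOn_Ioc_of_le Real.two_pi_pos.le]
    have h1 := (integrable_smul_measure (by simp [ENNReal.mul_eq_top])
      (by simp [Real.pi_pos])).1 hu
    exact h1.comp_measurable Circle.exp.continuous.measurable
  have hloc : LocallyIntegrable (fun t : ℝ => u (Circle.exp t)) := by
    intro x
    refine ⟨Icc (x - 1) (x + 1), Icc_mem_nhds (by linarith) (by linarith), ?_⟩
    rw [integrableOn_Icc_iff_integrableOn_Ioc,
      ← intervalIntegrable_iff_integrableOn_Ioc_of_le (by linarith)]
    exact hper.intervalIntegrable₀ Real.two_pi_pos.ne' hint _ _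
  refine ae_circleMeasure_of_ae ?_
  filter_upwards [ae_tendsto_integral_poissonKernel_sub hloc] with x hx
  rw [← tendsto_sub_nhds_zero_iff]
  have h2 := hx.const_smul (2 * Real.pi)⁻¹
  rw [smul_zero] at h2
  refine h2.congr' ?_
  filter_upwards [Ioo_mem_nhdsLT (show (0 : ℝ) < 1 by norm_num)] with r hr
  have hw : ‖(r : ℂ) * Circle.exp x‖ < 1 := by
    rw [norm_mul, Circle.norm_coe, Complex.norm_real, Real.norm_of_nonneg hr.1.le, mul_one]
    exact hr.2
  have h3 := integral_poissonKernel_pow hw 0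
  simp only [pow_zero] at h3
  have h4 : u (Circle.exp x) = ∫ z : Circle,
      poissonKernel 0 (r * Circle.exp x) z • u (Circle.exp x) ∂circleMeasure := by
    have h5 := congrArg (· * u (Circle.exp x)) h3
    simp only [one_mul, ← integral_mul_const] at h5
    refine h5.symm.trans (integral_congr_ae (Eventually.of_forall fun z => ?_))
    simp only [Complex.real_smul, mul_one]
  conv_rhs => rw [h4]
  rw [← integral_sub (integrable_poissonKernel_smul hu hw)
    (integrable_poissonKernel_smul (integrable_const _) hw), integral_circleMeasure,
    ← intervalIntegral.integral_of_le (by linarith [Real.pi_pos])]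
  congr 1
  have hper2 : Function.Periodic (fun t : ℝ =>
      poissonKernel 0 (r * Circle.exp x) (Circle.exp t) • u (Circle.exp t) -
      poissonKernel 0 (r * Circle.exp x) (Circle.exp t) • u (Circle.exp x)) (2 * Real.pi) :=
    fun t => by simp only [Circle.periodic_exp t]
  have h5 := hper2.intervalIntegral_add_eq (x - Real.pi) 0
  rw [show x - Real.pi + 2 * Real.pi = x + Real.pi by ring, zero_add] at h5
  rw [← h5]
  simp only [smul_sub]

/-- A power series with square-summable coefficients is the Poisson integral of the function on the
circle whose Fourier coefficients are those of the series. -/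
theorem exists_boundary_function {a : ℕ → ℂ} (ha : Summable fun n => ‖a n‖ ^ 2) :
    ∃ u : Circle → ℂ, MemLp u 2 circleMeasure ∧
      ∫⁻ c, ‖u c‖ₑ ^ 2 ∂circleMeasure = ∑' n, ‖a n‖ₑ ^ 2 ∧
      ∀ w : ℂ, ‖w‖ < 1 →
        HasSum (fun n => a n * w ^ n) (∫ c : Circle, poissonKernel 0 w c • u c ∂circleMeasure) := by
  set e := AddCircle.homeomorphCircle'
  have hinj : Function.Injective (Nat.cast : ℕ → ℤ) := Nat.cast_injective
  set b : ℤ → ℂ := Function.extend (Nat.cast : ℕ → ℤ) a 0 with hb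
  have hbn : ∀ n : ℕ, b n = a n := fun n => hinj.extend_apply _ _ _
  have hb0 : ∀ i : ℤ, i ∉ range (Nat.cast : ℕ → ℤ) → b i = 0 := fun i hi =>
    Function.extend_apply' _ _ _ fun ⟨n, hn⟩ => hi ⟨n, hn⟩
  have hbmem : Memℓp b 2 := by
    refine memℓp_gen ?_
    simp only [ENNReal.toReal_ofNat, Real.rpow_ofNat]
    refine (hinj.summable_iff fun i hi => by simp [hb0 i hi]).1 ?_
    simpa only [Function.comp_def, hbn] using ha
  set c : lp (fun _ : ℤ => ℂ) 2 := ⟨b, hbmem⟩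
  set U : Lp ℂ 2 (AddCircle.haarAddCircle (T := 2 * Real.pi)) := fourierBasis.repr.symm c
  have hmp : MeasurePreserving e.symm circleMeasure
      (AddCircle.haarAddCircle (T := 2 * Real.pi)) :=
    measurePreserving_homeomorphCircle'.symm e.toMeasurableEquiv
  refine ⟨fun z => U (e.symm z), (Lp.memLp U).comp_measurePreserving hmp, ?_, ?_⟩
  · have h1 : ∫⁻ z, ‖U (e.symm z)‖ₑ ^ 2 ∂circleMeasure =
        ∫⁻ x, ‖U x‖ₑ ^ 2 ∂(AddCircle.haarAddCircle (T := 2 * Real.pi)) :=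
      hmp.lintegral_comp_emb e.symm.measurableEmbedding fun x => ‖U x‖ₑ ^ 2
    have h2 : ‖U‖ₑ ^ 2 = ∫⁻ x, ‖U x‖ₑ ^ 2 ∂(AddCircle.haarAddCircle (T := 2 * Real.pi)) := by
      rw [Lp.enorm_def, eLpNorm_eq_lintegral_rpow_enorm_toReal (by simp) (by simp),
        ← ENNReal.rpow_natCast, ← ENNReal.rpow_mul]
      simp
    have h3 : ‖U‖ = ‖c‖ := LinearIsometryEquiv.norm_map _ _
    have h4 : HasSum (fun i => ‖b i‖ ^ 2) (‖c‖ ^ 2) := by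
      have := lp.hasSum_norm (p := 2) (by simp) c
      simpa using this
    have h5 : HasSum (fun n => ‖a n‖ ^ 2) (‖c‖ ^ 2) := by
      have := (hinj.hasSum_iff (f := fun i => ‖b i‖ ^ 2) (a := ‖c‖ ^ 2)
        fun i hi => by simp [hb0 i hi]).2 h4
      simpa only [Function.comp_def, hbn] using this
    rw [h1, ← h2, ← ofReal_norm, h3, ← ENNReal.ofReal_pow (norm_nonneg _), ← h5.tsum_eq,
      ENNReal.ofReal_tsum_of_nonneg (fun n => by positivity) h5.summable]
    refine tsum_congr fun n => ?_
    rw [ENNReal.ofReal_pow (norm_nonneg _), ofReal_norm]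
  · intro w hw
    set P : C(AddCircle (2 * Real.pi), ℂ) :=
      ⟨fun x => ((poissonKernel 0 w (e x) : ℝ) : ℂ), Complex.continuous_ofReal.comp
        ((continuous_poissonKernel hw).comp e.continuous)⟩
    set PL : Lp ℂ 2 (AddCircle.haarAddCircle (T := 2 * Real.pi)) :=
      ContinuousMap.toLp 2 AddCircle.haarAddCircle ℂ P
    have hinner : ∀ g : Lp ℂ 2 (AddCircle.haarAddCircle (T := 2 * Real.pi)),
        inner ℂ PL g = ∫ x, poissonKernel 0 w (e x) • g x ∂AddCircle.haarAddCircle := by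
      intro g
      rw [L2.inner_def]
      refine integral_congr_ae ?_
      filter_upwards [ContinuousMap.coeFn_toLp (p := 2) (𝕜 := ℂ) AddCircle.haarAddCircle P]
        with x hx
      rw [hx]
      simp [P, RCLike.inner_apply, mul_comm]
    have hcirc : ∀ g : AddCircle (2 * Real.pi) → ℂ,
        ∫ z : Circle, poissonKernel 0 w z • g (e.symm z) ∂circleMeasure =
          ∫ x, poissonKernel 0 w (e x) • g x ∂AddCircle.haarAddCircle := by
      intro g
      rw [← measurePreserving_homeomorphCircle'.integral_comp e.measurableEmbedding]
      simp only [e, Homeomorph.symm_apply_apply]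
    have h1 : HasSum (fun i => c i • fourierLp (T := 2 * Real.pi) 2 i) U := by
      have := HilbertBasis.hasSum_repr_symm (fourierBasis (T := 2 * Real.pi)) c
      rwa [coe_fourierBasis] at this
    -- The Poisson integral of the Fourier series of `U` may be taken termwise.
    have h2 := (innerSL ℂ PL).hasSum h1
    simp only [innerSL_apply_apply, inner_smul_right] at h2
    rw [hinner U, ← hcirc] at h2
    have h3 := (hinj.hasSum_iff (f := fun i => c i * inner ℂ PL (fourierLp (T := 2 * Real.pi) 2 i))
      fun i hi => by
        have : c i = 0 := hb0 i hi
        simp [this]).2 h2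
    convert h3 using 1
    ext n
    have h4 : inner ℂ PL (fourierLp (T := 2 * Real.pi) 2 (n : ℤ)) = w ^ n := by
      rw [← integral_poissonKernel_pow hw, hinner]
      refine Eq.trans (integral_congr_ae ?_)
        (measurePreserving_homeomorphCircle'.integral_comp e.measurableEmbedding _)
      filter_upwards [coeFn_fourierLp (T := 2 * Real.pi) 2 (n : ℤ)] with x hx
      rw [hx, fourier_eq_zpow, zpow_natCast]
    have h5 : c (n : ℤ) = a n := hbn n
    rw [Function.comp_apply, h4, h5]

/-! ### The Hardy space of the disk -/

theorem exists_hasSum_of_differentiableOn {F : ℂ → ℂ}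
    (hF : DifferentiableOn ℂ F (Metric.ball 0 1)) :
    ∃ a : ℕ → ℂ, ∀ w : ℂ, ‖w‖ < 1 → HasSum (fun n => a n * w ^ n) (F w) := by
  refine ⟨fun n => (n.factorial : ℂ)⁻¹ * iteratedDeriv n F 0, fun w hw => ?_⟩
  have h := Complex.hasSum_taylorSeries_on_ball (r := 1) (c := 0) (f := F) (by simpa using hF)
    (z := w) (by simpa using hw)
  simpa [mul_comm, mul_assoc, mul_left_comm] using h

theorem summable_sq_of_hasSum {F : ℂ → ℂ} {a : ℕ → ℂ}
    (ha : ∀ w : ℂ, ‖w‖ < 1 → HasSum (fun n => a n * w ^ n) (F w)) {r : ℝ} (hr : r ∈ Ioo (0 : ℝ) 1) :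
    Summable fun n => ‖a n * (r : ℂ) ^ n‖ ^ 2 := by
  have hs : Summable fun n => ‖a n * (r : ℂ) ^ n‖ :=
    (ha r (by simpa [abs_of_pos hr.1] using hr.2)).summable.norm
  refine hs.of_norm_bounded_eventually_nat ?_
  filter_upwards [hs.tendsto_atTop_zero.eventually (gt_mem_nhds zero_lt_one)] with n hn
  rw [Real.norm_of_nonneg (by positivity), sq]
  exact mul_le_of_le_one_left (norm_nonneg _) hn.le

theorem norm_ofReal_mul_circle {r : ℝ} (hr : 0 ≤ r) (c : Circle) : ‖(r : ℂ) * c‖ = r := by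
  rw [norm_mul, Circle.norm_coe, Complex.norm_real, Real.norm_of_nonneg hr, mul_one]

/-- Parseval's identity on a circle inside the disk. -/
theorem lintegral_circle_eq_tsum {F : ℂ → ℂ} (hF : DifferentiableOn ℂ F (Metric.ball 0 1))
    {a : ℕ → ℂ} (ha : ∀ w : ℂ, ‖w‖ < 1 → HasSum (fun n => a n * w ^ n) (F w)) {r : ℝ}
    (hr : r ∈ Ioo (0 : ℝ) 1) :
    ∫⁻ c : Circle, ‖F (r * c)‖ₑ ^ 2 ∂circleMeasure = ∑' n, ‖a n * (r : ℂ) ^ n‖ₑ ^ 2 := by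
  obtain ⟨u, hu, hnorm, hsum⟩ := exists_boundary_function (summable_sq_of_hasSum ha hr)
  rw [← hnorm]
  refine lintegral_congr_ae ?_
  filter_upwards [ae_tendsto_integral_poissonKernel (hu.integrable (by norm_num))] with c hc
  have hmem : (r : ℂ) * c ∈ Metric.ball (0 : ℂ) 1 := by
    rw [mem_ball_zero_iff, norm_ofReal_mul_circle hr.1.le]
    exact hr.2
  have hlim : Tendsto (fun s : ℝ => F (r * (s * c))) (𝓝[<] 1) (𝓝 (F (r * c))) := by
    have h1 : ContinuousAt F (r * c) :=
      (hF.differentiableAt (Metric.isOpen_ball.mem_nhds hmem)).continuousAt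
    have h2 : Tendsto (fun s : ℝ => (r : ℂ) * (s * c)) (𝓝[<] 1) (𝓝 (r * c)) := by
      have : Continuous fun s : ℝ => (r : ℂ) * (s * c) := by fun_prop
      simpa using (this.tendsto 1).mono_left nhdsWithin_le_nhds
    exact h1.tendsto.comp h2
  -- The Poisson integral of `u` is `w ↦ F (r w)`, which is continuous up to the circle.
  have heq : u c = F (r * c) := by
    refine tendsto_nhds_unique (hc.congr' ?_) hlim
    filter_upwards [Ioo_mem_nhdsLT (show (0 : ℝ) < 1 by norm_num)] with s hs
    have h1 : ‖(s : ℂ) * c‖ < 1 := by rw [norm_ofReal_mul_circle hs.1.le]; exact hs.2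
    have h2 : ‖(r : ℂ) * (s * c)‖ < 1 := by
      rw [norm_mul, norm_ofReal_mul_circle hs.1.le, Complex.norm_real,
        Real.norm_of_nonneg hr.1.le]
      nlinarith [hr.1, hr.2, hs.1, hs.2]
    refine (hsum _ h1).unique ?_
    simpa only [mul_pow, mul_assoc] using ha _ h2
  rw [heq]

theorem monotoneOn_lintegral_circle {F : ℂ → ℂ} (hF : DifferentiableOn ℂ F (Metric.ball 0 1)) :
    MonotoneOn (fun r : ℝ => ∫⁻ c : Circle, ‖F (r * c)‖ₑ ^ 2 ∂circleMeasure) (Ioo 0 1) := by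
  obtain ⟨a, ha⟩ := exists_hasSum_of_differentiableOn hF
  intro r hr s hs hrs
  simp only [lintegral_circle_eq_tsum hF ha hr, lintegral_circle_eq_tsum hF ha hs]
  refine ENNReal.tsum_le_tsum fun n => ?_
  rw [enorm_mul, enorm_mul, enorm_pow, enorm_pow]
  gcongr ?_ ^ 2
  gcongr ‖a n‖ₑ * ?_ ^ n
  rw [← ofReal_norm, ← ofReal_norm, Complex.norm_real, Complex.norm_real]
  refine ENNReal.ofReal_le_ofReal ?_
  rwa [Real.norm_of_nonneg hr.1.le, Real.norm_of_nonneg hs.1.le]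

theorem iSup_lintegral_circle_eq_tsum {F : ℂ → ℂ} (hF : DifferentiableOn ℂ F (Metric.ball 0 1))
    {a : ℕ → ℂ} (ha : ∀ w : ℂ, ‖w‖ < 1 → HasSum (fun n => a n * w ^ n) (F w)) :
    ⨆ r ∈ Ioo (0 : ℝ) 1, ∫⁻ c : Circle, ‖F (r * c)‖ₑ ^ 2 ∂circleMeasure = ∑' n, ‖a n‖ₑ ^ 2 := by
  refine le_antisymm (iSup₂_le fun r hr => ?_) ?_
  · rw [lintegral_circle_eq_tsum hF ha hr]
    refine ENNReal.tsum_le_tsum fun n => ?_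
    gcongr ?_ ^ 2
    rw [← ofReal_norm, ← ofReal_norm, norm_mul, norm_pow, Complex.norm_real,
      Real.norm_of_nonneg hr.1.le]
    exact ENNReal.ofReal_le_ofReal
      (mul_le_of_le_one_right (norm_nonneg _) (pow_le_one₀ hr.1.le hr.2.le))
  · rw [ENNReal.tsum_eq_iSup_sum]
    refine iSup_le fun s => ?_
    have hlim : Tendsto (fun r : ℝ => ∑ n ∈ s, ‖a n * (r : ℂ) ^ n‖ₑ ^ 2) (𝓝[<] 1)
        (𝓝 (∑ n ∈ s, ‖a n‖ₑ ^ 2)) := by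
      have : Continuous fun r : ℝ => ∑ n ∈ s, ‖a n * (r : ℂ) ^ n‖ₑ ^ 2 :=
        continuous_finsetSum _ fun n _ => (ENNReal.continuous_pow 2).comp (by fun_prop)
      simpa using (this.tendsto 1).mono_left (nhdsWithin_le_nhds (s := Iio 1))
    refine le_of_tendsto hlim ?_
    filter_upwards [Ioo_mem_nhdsLT (show (0 : ℝ) < 1 by norm_num)] with r hr
    refine le_trans ?_ (le_iSup₂ (f := fun (r : ℝ) (_ : r ∈ Ioo (0 : ℝ) 1) =>
      ∫⁻ c : Circle, ‖F (r * c)‖ₑ ^ 2 ∂circleMeasure) r hr)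
    rw [lintegral_circle_eq_tsum hF ha hr]
    exact ENNReal.sum_le_tsum s

/-- Fatou's theorem and the isometry property of boundary values for the Hardy space of the disk. -/
theorem exists_radial_limit_disk {F : ℂ → ℂ} (hF : DifferentiableOn ℂ F (Metric.ball 0 1))
    (hfin : ⨆ r ∈ Ioo (0 : ℝ) 1, ∫⁻ c : Circle, ‖F (r * c)‖ₑ ^ 2 ∂circleMeasure < ⊤) :
    ∃ u : Circle → ℂ, MemLp u 2 circleMeasure ∧
      (∀ᵐ c : Circle ∂circleMeasure,
        Tendsto (fun r : ℝ => F (r * c)) (𝓝[<] 1) (𝓝 (u c))) ∧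
      ∫⁻ c, ‖u c‖ₑ ^ 2 ∂circleMeasure =
        ⨆ r ∈ Ioo (0 : ℝ) 1, ∫⁻ c : Circle, ‖F (r * c)‖ₑ ^ 2 ∂circleMeasure ∧
      ∫ c, u c ∂circleMeasure = F 0 := by
  obtain ⟨a, ha⟩ := exists_hasSum_of_differentiableOn hF
  rw [iSup_lintegral_circle_eq_tsum hF ha] at hfin ⊢
  have hs : Summable fun n => ‖a n‖ ^ 2 := by
    have h := ENNReal.summable_toReal hfin.ne
    simpa using h
  obtain ⟨u, hu, hnorm, hsum⟩ := exists_boundary_function hs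
  refine ⟨u, hu, ?_, hnorm, ?_⟩
  · filter_upwards [ae_tendsto_integral_poissonKernel (hu.integrable (by norm_num))] with c hc
    refine hc.congr' ?_
    filter_upwards [Ioo_mem_nhdsLT (show (0 : ℝ) < 1 by norm_num)] with s hs
    have h1 : ‖(s : ℂ) * c‖ < 1 := by rw [norm_ofReal_mul_circle hs.1.le]; exact hs.2
    exact (hsum _ h1).unique (ha _ h1)
  · have h := (hsum 0 (by simp)).unique (ha 0 (by simp))
    simpa [poissonKernel_def] using h

/-! ### Rotations of the distinguished boundary and slices -/

theorem measurePreserving_circle_smul (m : ℕ) (c : Circle) :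
    MeasurePreserving (fun v : EuclideanSpace ℂ (Fin m) => (c : ℂ) • v) := by
  let L : EuclideanSpace ℂ (Fin m) ≃ₗᵢ[ℝ] EuclideanSpace ℂ (Fin m) :=
    { toFun := fun v => (c : ℂ) • v
      invFun := fun v => (c : ℂ)⁻¹ • v
      map_add' := fun v w => smul_add _ _ _
      map_smul' := fun a v => smul_comm _ _ _
      left_inv := fun v => inv_smul_smul₀ (Circle.coe_ne_zero c) v
      right_inv := fun v => smul_inv_smul₀ (Circle.coe_ne_zero c) v
      norm_map' := fun v => by
        change ‖(c : ℂ) • v‖ = ‖v‖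
        rw [norm_smul, Circle.norm_coe, one_mul] }
  exact L.measurePreserving

/-- Multiplication by a unimodular scalar on the unit sphere of `ℂᵐ`. -/
def rotateSphere {m : ℕ} (c : Circle) (x : Metric.sphere (0 : EuclideanSpace ℂ (Fin m)) 1) :
    Metric.sphere (0 : EuclideanSpace ℂ (Fin m)) 1 :=
  ⟨(c : ℂ) • (x : EuclideanSpace ℂ (Fin m)), by
    rw [mem_sphere_zero_iff_norm, norm_smul, Circle.norm_coe, norm_eq_of_mem_sphere, one_mul]⟩

theorem continuous_rotateSphere {m : ℕ} :
    Continuous fun p : Circle × Metric.sphere (0 : EuclideanSpace ℂ (Fin m)) 1 =>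
      rotateSphere p.1 p.2 := by
  refine Continuous.subtype_mk ?_ _
  fun_prop

open scoped Pointwise in
/-- Surface measure is rotation invariant because the cone over a rotated set is the rotated
cone. -/
theorem measurePreserving_rotateSphere (m : ℕ) (c : Circle) :
    MeasurePreserving (rotateSphere (m := m) c) (sphereMeasure m) (sphereMeasure m) := by
  have hmeas : Measurable (rotateSphere (m := m) c) :=
    (continuous_rotateSphere.comp (Continuous.prodMk_right c)).measurable
  refine MeasurePreserving.smul_measure ⟨hmeas, ?_⟩ _
  ext s hs
  rw [Measure.map_apply hmeas hs, Measure.toSphere_apply' _ hs,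
    Measure.toSphere_apply' _ (hmeas hs)]
  have hemb : MeasurableEmbedding (fun v : EuclideanSpace ℂ (Fin m) => (c : ℂ) • v) :=
    (Homeomorph.smulOfNeZero (c : ℂ) (Circle.coe_ne_zero c)).measurableEmbedding
  rw [← (measurePreserving_circle_smul m c).measure_preimage_emb hemb
    (Ioo (0 : ℝ) 1 • ((↑) '' s : Set (EuclideanSpace ℂ (Fin m))))]
  congr 2
  ext v
  simp only [Set.mem_smul, mem_preimage]
  constructor
  · rintro ⟨t, ht, _, ⟨x, hx, rfl⟩, rfl⟩
    exact ⟨t, ht, _, ⟨_, hx, rfl⟩, smul_comm t (c : ℂ) (x : EuclideanSpace ℂ (Fin m))⟩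
  · rintro ⟨t, ht, _, ⟨y, hy, rfl⟩, h⟩
    have hc := Circle.coe_ne_zero c
    refine ⟨t, ht, _, ⟨rotateSphere c⁻¹ y, ?_, rfl⟩, ?_⟩
    · have : rotateSphere c (rotateSphere c⁻¹ y) = y := by
        refine Subtype.ext ?_
        simp [rotateSphere, smul_smul]
      rwa [mem_preimage, this]
    · have h1 : v = (c : ℂ)⁻¹ • ((c : ℂ) • v) := (inv_smul_smul₀ hc v).symm
      rw [h1, ← h]
      simp only [rotateSphere, Circle.coe_inv]
      exact smul_comm _ _ _

instance instIsProbabilityMeasureSphere {m : ℕ} [NeZero m] :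
    IsProbabilityMeasure (sphereMeasure m) := by
  refine ⟨?_⟩
  have : Nontrivial (EuclideanSpace ℂ (Fin m)) := by
    have : Nonempty (Fin m) := ⟨0⟩
    infer_instance
  rw [sphereMeasure, Measure.smul_apply, smul_eq_mul]
  exact ENNReal.inv_mul_cancel
    (Measure.measure_univ_ne_zero.2 (Measure.toSphere_ne_zero _))
    (measure_ne_top _ _)

variable {k : ℕ} {n : Fin k → ℕ}

instance instIsProbabilityMeasureBoundary [∀ j, NeZero (n j)] :
    IsProbabilityMeasure (boundaryMeasure n) := by
  unfold boundaryMeasure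
  infer_instance

/-- The action of the circle on the distinguished boundary by simultaneous rotation of all
factors. -/
def rotate (ζ : Boundary n) (c : Circle) : Boundary n := fun j => rotateSphere c (ζ j)

theorem continuous_rotate : Continuous fun p : Boundary n × Circle => rotate p.1 p.2 :=
  continuous_pi fun j => continuous_rotateSphere.comp
    (continuous_snd.prodMk ((continuous_apply j).comp continuous_fst))

/-- Rotating a `Σ`-random point by an independent random element of the circle does not change its
distribution. -/
theorem measurePreserving_rotate [∀ j, NeZero (n j)] :
    MeasurePreserving (fun p : Boundary n × Circle => rotate p.1 p.2)
      ((boundaryMeasure n).prod circleMeasure) (boundaryMeasure n) := by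
  have h1 : ∀ c : Circle, MeasurePreserving (fun ζ : Boundary n => rotate ζ c)
      (boundaryMeasure n) (boundaryMeasure n) := fun c =>
    measurePreserving_pi _ _ fun j => measurePreserving_rotateSphere (n j) c
  have h2 : MeasurePreserving (fun p : Circle × Boundary n => (p.1, rotate p.2 p.1))
      (circleMeasure.prod (boundaryMeasure n)) (circleMeasure.prod (boundaryMeasure n)) :=
    (MeasurePreserving.id circleMeasure).skew_product (g := fun c ζ => rotate ζ c)
      (continuous_rotate.comp continuous_swap).measurable
      (Eventually.of_forall fun c => (h1 c).map_eq)
  exact measurePreserving_snd.comp (h2.comp Measure.measurePreserving_swap)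

/-- A property that holds at almost every point of almost every circle orbit holds almost
everywhere. -/
theorem ae_of_ae_rotate [∀ j, NeZero (n j)] {p : Boundary n → Prop} (hp : MeasurableSet {ζ | p ζ})
    (h : ∀ᵐ ζ ∂boundaryMeasure n, ∀ᵐ c ∂circleMeasure, p (rotate ζ c)) :
    ∀ᵐ ζ ∂boundaryMeasure n, p ζ := by
  rw [← measurePreserving_rotate.map_eq, ae_map_iff continuous_rotate.measurable.aemeasurable hp]
  exact (Measure.ae_prod_iff_ae_ae (continuous_rotate.measurable hp)).2 h

theorem lintegral_rotate [∀ j, NeZero (n j)] {φ : Boundary n → ℝ≥0∞}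
    (hφ : AEMeasurable φ (boundaryMeasure n)) :
    ∫⁻ ζ, φ ζ ∂boundaryMeasure n =
      ∫⁻ ζ, ∫⁻ c, φ (rotate ζ c) ∂circleMeasure ∂boundaryMeasure n := by
  have h : AEMeasurable φ (Measure.map (fun p : Boundary n × Circle => rotate p.1 p.2)
      ((boundaryMeasure n).prod circleMeasure)) := by rwa [measurePreserving_rotate.map_eq]
  conv_lhs => rw [← measurePreserving_rotate.map_eq]
  rw [lintegral_map' h continuous_rotate.measurable.aemeasurable]
  exact lintegral_prod _ (h.comp_aemeasurable continuous_rotate.measurable.aemeasurable)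

theorem integral_rotate [∀ j, NeZero (n j)] {φ : Boundary n → ℂ}
    (hφ : Integrable φ (boundaryMeasure n)) :
    ∫ ζ, φ ζ ∂boundaryMeasure n =
      ∫ ζ, ∫ c, φ (rotate ζ c) ∂circleMeasure ∂boundaryMeasure n := by
  have h := measurePreserving_rotate.integrable_comp_of_integrable hφ
  have h' : AEStronglyMeasurable φ (Measure.map (fun p : Boundary n × Circle => rotate p.1 p.2)
      ((boundaryMeasure n).prod circleMeasure)) := by
    rw [measurePreserving_rotate.map_eq]; exact hφ.1
  conv_lhs => rw [← measurePreserving_rotate.map_eq]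
  rw [integral_map continuous_rotate.measurable.aemeasurable h']
  exact integral_prod _ h

/-- The restriction of a function on `𝓓` to the disk through `0` and the boundary point `ζ`. -/
def slice (f : Space n → ℂ) (ζ : Boundary n) (w : ℂ) : ℂ :=
  f fun j => w • (ζ j : EuclideanSpace ℂ (Fin (n j)))

theorem slice_zero (f : Space n → ℂ) (ζ : Boundary n) : slice f ζ 0 = f 0 := by
  simp only [slice, zero_smul]; rfl

theorem slice_mul_circle (f : Space n → ℂ) (ζ : Boundary n) (r : ℝ) (c : Circle) :
    slice f ζ (r * c) = f (dilate r (rotate ζ c)) := by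
  unfold slice dilate rotate rotateSphere
  congr 1
  ext1 j
  rw [mul_smul]
  rfl

theorem differentiableOn_slice {f : Space n → ℂ} (hf : DifferentiableOn ℂ f (domain n))
    (ζ : Boundary n) : DifferentiableOn ℂ (slice f ζ) (Metric.ball 0 1) := by
  refine hf.comp (t := domain n) ?_ fun w hw j => ?_
  · refine Differentiable.differentiableOn (differentiable_pi.2 fun j => ?_)
    exact differentiable_id.smul_const _
  · simpa [norm_smul] using hw

theorem dilate_mem_domain {r : ℝ} (hr : r ∈ Ioo (0 : ℝ) 1) (ζ : Boundary n) :
    dilate r ζ ∈ domain n := fun j => by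
  simpa [dilate, norm_smul, abs_of_pos hr.1] using hr.2

theorem continuous_dilate (r : ℝ) : Continuous (dilate (n := n) r) := by
  unfold dilate
  fun_prop

theorem continuous_comp_dilate {f : Space n → ℂ} (hf : DifferentiableOn ℂ f (domain n)) {r : ℝ}
    (hr : r ∈ Ioo (0 : ℝ) 1) : Continuous fun ζ : Boundary n => f (dilate r ζ) :=
  hf.continuousOn.comp_continuous (continuous_dilate r) (dilate_mem_domain hr)

/-- For functions continuous on `(0, 1)`, limits at `1` may be taken along the rationals. -/
theorem tendsto_of_tendsto_rat {g : ℝ → ℂ} (hg : ContinuousOn g (Ioo 0 1)) {w : ℂ}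
    (h : Tendsto (fun q : ℚ => g q) (comap (↑) (𝓝[<] (1 : ℝ))) (𝓝 w)) :
    Tendsto g (𝓝[<] 1) (𝓝 w) := by
  refine (closed_nhds_basis w).tendsto_right_iff.2 fun U ⟨hU, hUc⟩ => ?_
  obtain ⟨t, ht, hts⟩ := h hU
  obtain ⟨a, ha, hat⟩ := (mem_nhdsLT_iff_exists_Ioo_subset' (show (0 : ℝ) < 1 by norm_num)).1
    (inter_mem ht (Ioo_mem_nhdsLT (show (0 : ℝ) < 1 by norm_num)))
  filter_upwards [Ioo_mem_nhdsLT ha] with r hr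
  have hr01 : r ∈ Ioo (0 : ℝ) 1 := (hat hr).2
  have h1 : r ∈ closure (Ioo a 1 ∩ range ((↑) : ℚ → ℝ)) :=
    Rat.isDenseEmbedding_coe_real.dense.open_subset_closure_inter isOpen_Ioo hr
  have h2 := mem_closure_image (hg.continuousAt (isOpen_Ioo.mem_nhds hr01)) h1
  refine closure_minimal ?_ hUc h2
  rintro _ ⟨_, ⟨hq, q, rfl⟩, rfl⟩
  exact hts (hat hq).1

theorem continuousOn_dilate {f : Space n → ℂ} (hf : DifferentiableOn ℂ f (domain n))
    (ζ : Boundary n) : ContinuousOn (fun r : ℝ => f (dilate r ζ)) (Ioo 0 1) := by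
  refine hf.continuousOn.comp (t := domain n) (Continuous.continuousOn ?_)
    fun r hr => dilate_mem_domain hr ζ
  unfold dilate
  fun_prop

/-- The set of points with a radial limit is measurable: by continuity in the radius, only rational
radii, hence countably many functions, matter. -/
theorem measurableSet_exists_tendsto_dilate {f : Space n → ℂ}
    (hf : DifferentiableOn ℂ f (domain n)) :
    MeasurableSet {ζ : Boundary n | ∃ w,
      Tendsto (fun r : ℝ => f (dilate r ζ)) (𝓝[<] 1) (𝓝 w)} := by
  classical
  let F : ℚ → Boundary n → ℂ := fun q ζ =>
    if (q : ℝ) ∈ Ioo (0 : ℝ) 1 then f (dilate q ζ) else 0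
  have hF : ∀ q, StronglyMeasurable (F q) := by
    intro q
    by_cases hq : (q : ℝ) ∈ Ioo (0 : ℝ) 1
    · simp only [F, if_pos hq]
      exact (continuous_comp_dilate hf hq).stronglyMeasurable
    · simp only [F, if_neg hq]
      exact stronglyMeasurable_const
  have := StronglyMeasurable.measurableSet_exists_tendsto
    (l := comap ((↑) : ℚ → ℝ) (𝓝[<] (1 : ℝ))) hF
  refine this.congr ?_
  ext ζ
  refine exists_congr fun w => ?_
  have hev : (fun q : ℚ => f (dilate q ζ)) =ᶠ[comap ((↑) : ℚ → ℝ) (𝓝[<] (1 : ℝ))]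
      fun q => F q ζ := by
    filter_upwards [preimage_mem_comap (Ioo_mem_nhdsLT (show (0 : ℝ) < 1 by norm_num))] with q hq
    exact (if_pos hq).symm
  rw [← tendsto_congr' hev]
  exact ⟨tendsto_of_tendsto_rat (continuousOn_dilate hf ζ), fun h => h.comp tendsto_comap⟩

/-! ### Boundary values of Hardy functions on the product domain -/


/-- A sequence of radii increasing to `1`. -/
def radius (m : ℕ) : ℝ := 1 - 1 / ((m : ℝ) + 2)

theorem radius_mem (m : ℕ) : radius m ∈ Ioo (0 : ℝ) 1 := by
  have h : (0 : ℝ) < (m : ℝ) + 2 := by positivity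
  constructor
  · rw [radius, sub_pos, div_lt_one h]; linarith [(Nat.cast_nonneg m : (0 : ℝ) ≤ m)]
  · rw [radius]; linarith [show 0 < 1 / ((m : ℝ) + 2) by positivity]

theorem radius_mono : Monotone radius := by
  intro a b hab
  have : (a : ℝ) ≤ b := by exact_mod_cast hab
  unfold radius
  gcongr

theorem tendsto_radius : Tendsto radius atTop (𝓝[<] 1) := by
  refine tendsto_nhdsWithin_iff.2 ⟨?_, Eventually.of_forall fun m => (radius_mem m).2⟩
  have h : Tendsto (fun m : ℕ => 1 / ((m : ℝ) + 2)) atTop (𝓝 0) :=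
    tendsto_const_nhds.div_atTop (tendsto_natCast_atTop_atTop.atTop_add tendsto_const_nhds)
  have h2 := (tendsto_const_nhds (x := (1 : ℝ))).sub h
  rwa [sub_zero] at h2

theorem iSup_Ioo_eq_iSup_radius {φ : ℝ → ℝ≥0∞} (hφ : MonotoneOn φ (Ioo 0 1)) :
    ⨆ r ∈ Ioo (0 : ℝ) 1, φ r = ⨆ m, φ (radius m) := by
  refine le_antisymm (iSup₂_le fun r hr => ?_) (iSup_le fun m =>
    le_iSup₂ (f := fun r (_ : r ∈ Ioo (0 : ℝ) 1) => φ r) (radius m) (radius_mem m))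
  obtain ⟨m, hm⟩ := ((tendsto_nhdsWithin_iff.1 tendsto_radius).1.eventually
    (lt_mem_nhds hr.2)).exists
  exact (hφ hr (radius_mem m) hm.le).trans (le_iSup (fun m => φ (radius m)) m)

variable {f g : Space n → ℂ}

theorem lintegral_slice [∀ j, NeZero (n j)] (hf : DifferentiableOn ℂ f (domain n)) {r : ℝ}
    (hr : r ∈ Ioo (0 : ℝ) 1) :
    ∫⁻ ζ, ‖f (dilate r ζ)‖ₑ ^ 2 ∂boundaryMeasure n =
      ∫⁻ ζ, ∫⁻ c : Circle, ‖slice f ζ (r * c)‖ₑ ^ 2 ∂circleMeasure ∂boundaryMeasure n := by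
  rw [lintegral_rotate ((continuous_comp_dilate hf hr).measurable.enorm.pow_const 2).aemeasurable]
  simp only [slice_mul_circle]

/-- The square of the Hardy norm on the product is the mean of those of the slices. -/
theorem hardyNormSq_eq_lintegral_slice [∀ j, NeZero (n j)] (hf : DifferentiableOn ℂ f (domain n)) :
    AEMeasurable (fun ζ => ⨆ r ∈ Ioo (0 : ℝ) 1,
      ∫⁻ c : Circle, ‖slice f ζ (r * c)‖ₑ ^ 2 ∂circleMeasure) (boundaryMeasure n) ∧
    hardyNormSq f = ∫⁻ ζ, ⨆ r ∈ Ioo (0 : ℝ) 1,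
      ∫⁻ c : Circle, ‖slice f ζ (r * c)‖ₑ ^ 2 ∂circleMeasure ∂boundaryMeasure n := by
  have hmono : ∀ ζ : Boundary n, MonotoneOn (fun r : ℝ =>
      ∫⁻ c : Circle, ‖slice f ζ (r * c)‖ₑ ^ 2 ∂circleMeasure) (Ioo 0 1) := fun ζ =>
    monotoneOn_lintegral_circle (differentiableOn_slice hf ζ)
  have hmeas : ∀ m, Measurable fun ζ : Boundary n =>
      ∫⁻ c : Circle, ‖slice f ζ (radius m * c)‖ₑ ^ 2 ∂circleMeasure := by
    intro m
    simp only [slice_mul_circle]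
    refine Measurable.lintegral_prod_right' (f := fun p : Boundary n × Circle =>
      ‖f (dilate (radius m) (rotate p.1 p.2))‖ₑ ^ 2) ?_
    have := ((continuous_comp_dilate hf (radius_mem m)).comp continuous_rotate).measurable
    exact this.enorm.pow_const 2
  have hsup : ∀ ζ : Boundary n, (⨆ r ∈ Ioo (0 : ℝ) 1,
      ∫⁻ c : Circle, ‖slice f ζ (r * c)‖ₑ ^ 2 ∂circleMeasure) =
      ⨆ m, ∫⁻ c : Circle, ‖slice f ζ (radius m * c)‖ₑ ^ 2 ∂circleMeasure := fun ζ =>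
    iSup_Ioo_eq_iSup_radius (hmono ζ)
  simp only [hsup]
  refine ⟨(Measurable.iSup hmeas).aemeasurable, ?_⟩
  rw [lintegral_iSup hmeas
    fun a b hab ζ => hmono ζ (radius_mem a) (radius_mem b) (radius_mono hab)]
  simp only [← lintegral_slice hf (radius_mem _)]
  refine iSup_Ioo_eq_iSup_radius
    (φ := fun r => ∫⁻ ζ, ‖f (dilate r ζ)‖ₑ ^ 2 ∂boundaryMeasure n) fun r hr s hs hrs => ?_
  simp only [lintegral_slice hf hr, lintegral_slice hf hs]
  exact lintegral_mono fun ζ => hmono ζ hr hs hrs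

theorem radialLimit_eq {ζ : Boundary n} {w : ℂ}
    (h : Tendsto (fun r : ℝ => f (dilate r ζ)) (𝓝[<] 1) (𝓝 w)) : radialLimit f ζ = w :=
  h.limUnder_eq

/-- Almost every slice of a Hardy function belongs to the Hardy space of the disk, and its boundary
function is given by the radial limits of the Hardy function. -/
theorem ae_slice_boundary [∀ j, NeZero (n j)] (hf : MemHardy f) :
    ∀ᵐ ζ ∂boundaryMeasure n,
      (∀ᵐ c ∂circleMeasure, ∃ w,
        Tendsto (fun r : ℝ => f (dilate r (rotate ζ c))) (𝓝[<] 1) (𝓝 w)) ∧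
      ∫⁻ c, ‖radialLimit f (rotate ζ c)‖ₑ ^ 2 ∂circleMeasure =
        (⨆ r ∈ Ioo (0 : ℝ) 1, ∫⁻ c : Circle, ‖slice f ζ (r * c)‖ₑ ^ 2 ∂circleMeasure) ∧
      ∫ c, radialLimit f (rotate ζ c) ∂circleMeasure = f 0 := by
  obtain ⟨hmeas, hnorm⟩ := hardyNormSq_eq_lintegral_slice hf.1
  filter_upwards [ae_lt_top' hmeas (hnorm ▸ hf.2).ne] with ζ hζ
  obtain ⟨u, -, hlim, hu, hmean⟩ := exists_radial_limit_disk (differentiableOn_slice hf.1 ζ) hζ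
  simp only [slice_mul_circle] at hlim
  have hae : (fun c => radialLimit f (rotate ζ c)) =ᵐ[circleMeasure] u := by
    filter_upwards [hlim] with c hc using radialLimit_eq hc
  refine ⟨hlim.mono fun c hc => ⟨_, hc⟩, ?_, ?_⟩
  · rw [← hu]
    refine lintegral_congr_ae ?_
    filter_upwards [hae] with c hc
    rw [hc]
  · rw [integral_congr_ae hae, hmean, slice_zero]

/-- Fatou's theorem: Hardy functions have radial limits almost everywhere. -/
theorem MemHardy.ae_tendsto [∀ j, NeZero (n j)] (hf : MemHardy f) :
    ∀ᵐ ζ ∂boundaryMeasure n,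
      Tendsto (fun r : ℝ => f (dilate r ζ)) (𝓝[<] 1) (𝓝 (radialLimit f ζ)) := by
  have h := ae_of_ae_rotate (measurableSet_exists_tendsto_dilate hf.1)
    ((ae_slice_boundary hf).mono fun ζ hζ => hζ.1)
  filter_upwards [h] with ζ ⟨w, hw⟩
  rwa [radialLimit_eq hw]

theorem aestronglyMeasurable_radialLimit (hf : DifferentiableOn ℂ f (domain n))
    (h : ∀ᵐ ζ ∂boundaryMeasure n,
      Tendsto (fun r : ℝ => f (dilate r ζ)) (𝓝[<] 1) (𝓝 (radialLimit f ζ))) :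
    AEStronglyMeasurable (radialLimit f) (boundaryMeasure n) :=
  aestronglyMeasurable_of_tendsto_ae atTop
    (fun m => (continuous_comp_dilate hf (radius_mem m)).aestronglyMeasurable)
    (h.mono fun _ hζ => hζ.comp tendsto_radius)

theorem MemHardy.lintegral_radialLimit [∀ j, NeZero (n j)] (hf : MemHardy f) :
    ∫⁻ ζ, ‖radialLimit f ζ‖ₑ ^ 2 ∂boundaryMeasure n = hardyNormSq f := by
  have h := (aestronglyMeasurable_radialLimit hf.1 hf.ae_tendsto).aemeasurable
  rw [lintegral_rotate (h.enorm.pow_const 2), (hardyNormSq_eq_lintegral_slice hf.1).2]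
  exact lintegral_congr_ae ((ae_slice_boundary hf).mono fun ζ hζ => hζ.2.1)

theorem MemHardy.memLp [∀ j, NeZero (n j)] (hf : MemHardy f) :
    MemLp (radialLimit f) 2 (boundaryMeasure n) := by
  refine ⟨aestronglyMeasurable_radialLimit hf.1 hf.ae_tendsto, ?_⟩
  rw [eLpNorm_lt_top_iff_lintegral_rpow_enorm_lt_top (by simp) (by simp)]
  simpa [hf.lintegral_radialLimit] using hf.2

theorem MemHardy.aemeasurable_enorm_sq [∀ j, NeZero (n j)] (hf : MemHardy f) :
    AEMeasurable (fun ζ => ‖radialLimit f ζ‖ₑ ^ 2) (boundaryMeasure n) :=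
  hf.memLp.aestronglyMeasurable.aemeasurable.enorm.pow_const 2

/-- The mean value property for boundary values. -/
theorem MemHardy.integral_radialLimit [∀ j, NeZero (n j)] (hf : MemHardy f) :
    ∫ ζ, radialLimit f ζ ∂boundaryMeasure n = f 0 := by
  rw [integral_rotate (hf.memLp.integrable (by norm_num)),
    integral_congr_ae ((ae_slice_boundary hf).mono fun ζ hζ => hζ.2.2)]
  simp

theorem MemHardy.add_const_mul [∀ j, NeZero (n j)] (hf : MemHardy f) (hg : MemHardy g) (a : ℂ) :
    MemHardy fun z => f z + a * g z := by
  refine ⟨hf.1.add (hg.1.const_mul a), lt_of_le_of_lt (iSup₂_le fun r hr => ?_)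
    (show 2 * hardyNormSq f + 2 * ‖a‖ₑ ^ 2 * hardyNormSq g < ⊤ from ?_)⟩
  · calc ∫⁻ ζ, ‖f (dilate r ζ) + a * g (dilate r ζ)‖ₑ ^ 2 ∂boundaryMeasure n
        ≤ ∫⁻ ζ, (2 * ‖f (dilate r ζ)‖ₑ ^ 2 + 2 * ‖a‖ₑ ^ 2 * ‖g (dilate r ζ)‖ₑ ^ 2)
            ∂boundaryMeasure n := by
          refine lintegral_mono fun ζ => ?_
          simp only [enorm_eq_nnnorm]
          norm_cast
          refine (pow_le_pow_left' (nnnorm_add_le _ _) 2).trans ?_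
          refine add_sq_le.trans_eq ?_
          rw [nnnorm_mul]; ring
      _ ≤ _ := by
          have hm := (continuous_comp_dilate hf.1 hr).measurable.enorm.pow_const 2
          rw [lintegral_add_left (hm.const_mul 2), lintegral_const_mul' _ _ (by simp),
            lintegral_const_mul' _ _ (by finiteness)]
          gcongr
          · exact le_iSup₂ (f := fun r (_ : r ∈ Ioo (0 : ℝ) 1) =>
              ∫⁻ ζ, ‖f (dilate r ζ)‖ₑ ^ 2 ∂boundaryMeasure n) r hr
          · exact le_iSup₂ (f := fun r (_ : r ∈ Ioo (0 : ℝ) 1) =>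
              ∫⁻ ζ, ‖g (dilate r ζ)‖ₑ ^ 2 ∂boundaryMeasure n) r hr
  · have h1 := hf.2; have h2 := hg.2
    finiteness

theorem MemHardy.bdd_mul (hf : MemHardy f) {I : Space n → ℂ}
    (hI : DifferentiableOn ℂ I (domain n)) (hI1 : ∀ z ∈ domain n, ‖I z‖ ≤ 1) :
    MemHardy fun z => I z * f z := by
  refine ⟨hI.mul hf.1, lt_of_le_of_lt (iSup₂_mono fun r hr => lintegral_mono fun ζ => ?_) hf.2⟩
  gcongr ?_ ^ 2
  rw [enorm_mul]
  refine mul_le_of_le_one_left' ?_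
  rw [← ofReal_norm]
  exact ENNReal.ofReal_le_one.2 (hI1 _ (dilate_mem_domain hr ζ))

theorem memHardy_one [∀ j, NeZero (n j)] : MemHardy fun _ : Space n => (1 : ℂ) :=
  ⟨differentiableOn_const _, lt_of_le_of_lt (b := 1) (iSup₂_le fun r _ => by simp) (by simp)⟩

/-! ### The model space of an inner function -/

variable {I : Space n → ℂ}

theorem zero_mem_domain : (0 : Space n) ∈ domain n := fun j => by simp

theorem IsInner.memHardy [∀ j, NeZero (n j)] (hI : IsInner I) : MemHardy I := by
  simpa using memHardy_one.bdd_mul hI.1 fun z hz => (hI.2.1 z hz).le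

theorem IsInner.pow_mul_memHardy (hI : IsInner I) (hf : MemHardy f) (m : ℕ) :
    MemHardy fun z => I z ^ m * f z :=
  hf.bdd_mul (I := fun z => I z ^ m) (hI.1.pow m) fun z hz => by
    rw [norm_pow]
    exact pow_le_one₀ (norm_nonneg _) (hI.2.1 z hz).le

/-- The boundary values of an inner function agree almost everywhere with a Borel map to the
circle. -/
theorem IsInner.exists_measurable_circle [∀ j, NeZero (n j)] (hI : IsInner I) :
    ∃ J : Boundary n → Circle, Measurable J ∧
      ∀ᵐ ζ ∂boundaryMeasure n, radialLimit I ζ = J ζ := by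
  have hm := hI.memHardy.memLp.aestronglyMeasurable.aemeasurable
  have hemb : MeasurableEmbedding (fun c : Circle => (c : ℂ)) :=
    ((by fun_prop : Continuous fun c : Circle => (c : ℂ)).isClosedEmbedding
      Circle.coe_injective).measurableEmbedding
  refine ⟨fun ζ => Function.extend (fun c : Circle => (c : ℂ)) (fun c => c) (fun _ => 1)
      (hm.mk _ ζ),
    (hemb.measurable_extend (g := fun c : Circle => c) measurable_id measurable_const).comp
      hm.measurable_mk, ?_⟩
  filter_upwards [hm.ae_eq_mk, hI.2.2] with ζ h1 ⟨w, hw, hlim⟩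
  rw [← h1, radialLimit_eq hlim]
  obtain ⟨c, rfl⟩ : ∃ c : Circle, (c : ℂ) = w := ⟨⟨w, mem_sphere_zero_iff_norm.2 hw⟩, rfl⟩
  exact congrArg (fun c : Circle => (c : ℂ)) (Circle.coe_injective.extend_apply
    (fun c : Circle => c) (fun _ => 1) c).symm

theorem radialLimit_pow_mul [∀ j, NeZero (n j)] (hI : IsInner I) (hf : MemHardy f) (m : ℕ) :
    radialLimit (fun z => I z ^ m * f z) =ᵐ[boundaryMeasure n]
      fun ζ => radialLimit I ζ ^ m * radialLimit f ζ := by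
  filter_upwards [hI.memHardy.ae_tendsto, hf.ae_tendsto] with ζ h1 h2
  exact radialLimit_eq ((h1.pow m).mul h2)

theorem radialLimit_mul [∀ j, NeZero (n j)] (hI : IsInner I) (hf : MemHardy f) :
    radialLimit (fun z => I z * f z) =ᵐ[boundaryMeasure n]
      fun ζ => radialLimit I ζ * radialLimit f ζ := by
  simpa using radialLimit_pow_mul hI hf 1

theorem radialLimit_add_const_mul [∀ j, NeZero (n j)] (hf : MemHardy f) (hg : MemHardy g) (a : ℂ) :
    radialLimit (fun z => f z + a * g z) =ᵐ[boundaryMeasure n]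
      fun ζ => radialLimit f ζ + a * radialLimit g ζ := by
  filter_upwards [hf.ae_tendsto, hg.ae_tendsto] with ζ h1 h2
  exact radialLimit_eq (h1.add (h2.const_mul a))

theorem integrable_mul_conj [∀ j, NeZero (n j)] (hf : MemHardy f) (hg : MemHardy g) :
    Integrable (fun ζ => radialLimit f ζ * conj (radialLimit g ζ)) (boundaryMeasure n) :=
  hf.memLp.integrable_mul hg.memLp.star

theorem hardyInner_add_const_mul [∀ j, NeZero (n j)] (hf : MemHardy f) (hg : MemHardy g)
    {h : Space n → ℂ} (hh : MemHardy h) (a : ℂ) :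
    hardyInner (fun z => f z + a * g z) h = hardyInner f h + a * hardyInner g h := by
  unfold hardyInner
  rw [← integral_const_mul, ← integral_add (integrable_mul_conj hf hh)
    ((integrable_mul_conj hg hh).const_mul a)]
  refine integral_congr_ae ?_
  filter_upwards [radialLimit_add_const_mul hf hg a] with ζ hζ
  rw [hζ]
  ring

theorem MemLargeModel.add_const_mul [∀ j, NeZero (n j)] (hI : IsInner I) (hf : MemLargeModel I f)
    (hg : MemLargeModel I g) (a : ℂ) : MemLargeModel I fun z => f z + a * g z := by
  refine ⟨hf.1.add_const_mul hg.1 a, fun h hh => ?_⟩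
  have hIh : MemHardy fun z => I z * h z := by simpa using hI.pow_mul_memHardy hh 1
  rw [hardyInner_add_const_mul hf.1 hg.1 hIh, hf.2 h hh, hg.2 h hh, mul_zero, add_zero]

/-- The reproducing kernel of `H² ⊖ I H²` at the origin belongs to this space. -/
theorem memLargeModel_kernel [∀ j, NeZero (n j)] (hI : IsInner I) :
    MemLargeModel I fun z => 1 + -conj (I 0) * I z := by
  refine ⟨memHardy_one.add_const_mul hI.memHardy _, fun h hh => ?_⟩
  have hIh : MemHardy fun z => I z * h z := by simpa using hI.pow_mul_memHardy hh 1
  have h1 : hardyInner (fun _ => 1) (fun z => I z * h z) = conj (I 0 * h 0) := by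
    unfold hardyInner
    rw [← hIh.integral_radialLimit, ← integral_conj]
    refine integral_congr_ae (Eventually.of_forall fun ζ => ?_)
    have : radialLimit (fun _ : Space n => (1 : ℂ)) ζ = 1 := radialLimit_eq tendsto_const_nhds
    simp only [this, one_mul]
  have h2 : hardyInner I (fun z => I z * h z) = conj (h 0) := by
    unfold hardyInner
    rw [← hh.integral_radialLimit, ← integral_conj]
    refine integral_congr_ae ?_
    obtain ⟨J, -, hJ⟩ := hI.exists_measurable_circle
    filter_upwards [radialLimit_mul hI hh, hJ] with ζ h3 h4
    rw [h3, h4, map_mul, ← mul_assoc, Complex.mul_conj, Complex.normSq_eq_norm_sq, Circle.norm_coe]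
    simp
  rw [hardyInner_add_const_mul memHardy_one hI.memHardy hIh, h1, h2, map_mul]
  ring

/-- The positive moments of the boundary values of `I` vanish for the measure `|f|² Σ`. -/
theorem MemLargeModel.moment_eq_zero [∀ j, NeZero (n j)] (hI : IsInner I) (hf : MemLargeModel I f)
    (m : ℕ) :
    ∫ ζ, ((‖radialLimit f ζ‖ ^ 2 : ℝ) : ℂ) * radialLimit I ζ ^ (m + 1) ∂boundaryMeasure n = 0 := by
  have h1 := hf.2 _ (hI.pow_mul_memHardy hf.1 m)
  have h2 := congrArg conj h1
  rw [map_zero, hardyInner, ← integral_conj] at h2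
  rw [← h2]
  refine integral_congr_ae ?_
  filter_upwards [radialLimit_pow_mul hI hf.1 (m + 1)] with ζ h3
  simp only [← mul_assoc, ← pow_succ']
  rw [h3, map_mul, Complex.conj_conj, ← Complex.normSq_eq_norm_sq, Complex.normSq_eq_conj_mul_self]
  ring

/-- The image of the measure `|f|² Σ` under the boundary values of `I` is a multiple of arc
length. -/
theorem MemLargeModel.map_withDensity [∀ j, NeZero (n j)] (hI : IsInner I) (hf : MemLargeModel I f)
    {J : Boundary n → Circle} (hJm : Measurable J)
    (hJ : ∀ᵐ ζ ∂boundaryMeasure n, radialLimit I ζ = J ζ) :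
    ((boundaryMeasure n).withDensity fun ζ => ‖radialLimit f ζ‖ₑ ^ 2).map J =
      hardyNormSq f • circleMeasure := by
  have hd := hf.1.aemeasurable_enorm_sq
  have huniv : ((boundaryMeasure n).withDensity fun ζ => ‖radialLimit f ζ‖ₑ ^ 2) univ =
      hardyNormSq f := by
    rw [withDensity_apply _ MeasurableSet.univ, Measure.restrict_univ, hf.1.lintegral_radialLimit]
  have : IsFiniteMeasure ((boundaryMeasure n).withDensity fun ζ => ‖radialLimit f ζ‖ₑ ^ 2) :=
    ⟨huniv ▸ hf.1.2⟩
  rw [eq_smul_circleMeasure (ν := Measure.map J _) fun m => ?_, Measure.map_apply hJm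
    MeasurableSet.univ, preimage_univ, huniv]
  rw [integral_map hJm.aemeasurable (by fun_prop),
    integral_withDensity_eq_integral_toReal_smul₀ hd (Eventually.of_forall fun ζ => by finiteness),
    ← hf.moment_eq_zero hI m]
  refine integral_congr_ae ?_
  filter_upwards [hJ] with ζ hζ
  simp [hζ]

/-- The boundary values of an inner function pull null sets of the circle back to null sets: the
reproducing kernel at the origin has no boundary zeros, so `Σ` is absolutely continuous with respect
to the measure it defines through `MemLargeModel.map_withDensity`. -/
theorem IsInner.quasiMeasurePreserving [∀ j, NeZero (n j)] (hI : IsInner I)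
    {J : Boundary n → Circle} (hJm : Measurable J)
    (hJ : ∀ᵐ ζ ∂boundaryMeasure n, radialLimit I ζ = J ζ) :
    Measure.QuasiMeasurePreserving J (boundaryMeasure n) circleMeasure := by
  have hK := memLargeModel_kernel hI
  refine ⟨hJm, ?_⟩
  have h1 : boundaryMeasure n ≪ (boundaryMeasure n).withDensity fun ζ =>
      ‖radialLimit (fun z => 1 + -conj (I 0) * I z) ζ‖ₑ ^ 2 := by
    refine withDensity_absolutelyContinuous'
      hK.1.aemeasurable_enorm_sq ?_
    filter_upwards [radialLimit_add_const_mul memHardy_one hI.memHardy (-conj (I 0)), hJ]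
      with ζ h2 h3
    have h4 : radialLimit (fun _ : Space n => (1 : ℂ)) ζ = 1 := radialLimit_eq tendsto_const_nhds
    rw [h2, h3, h4]
    refine pow_ne_zero _ (enorm_ne_zero.2 fun h0 => ?_)
    have h5 : conj (I 0) * J ζ = 1 := by linear_combination -h0
    have h6 := congrArg norm h5
    rw [norm_mul, Circle.norm_coe, RCLike.norm_conj, mul_one, norm_one] at h6
    exact (hI.2.1 0 zero_mem_domain).ne h6
  refine (h1.map hJm).trans ?_
  rw [hK.map_withDensity hI hJm hJ]
  exact Measure.smul_absolutelyContinuous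

theorem boundaryComp_ae_eq {J : Boundary n → Circle}
    (hJ : ∀ᵐ ζ ∂boundaryMeasure n, radialLimit I ζ = J ζ) (Φ : Circle → ℂ) :
    boundaryComp Φ I =ᵐ[boundaryMeasure n] fun ζ => Φ (J ζ) := by
  filter_upwards [hJ] with ζ hζ
  rw [boundaryComp, hζ]
  exact Circle.coe_injective.extend_apply Φ 0 (J ζ)

theorem boundaryPreimage_ae_eq {J : Boundary n → Circle}
    (hJ : ∀ᵐ ζ ∂boundaryMeasure n, radialLimit I ζ = J ζ) (Q : Set Circle) :
    boundaryPreimage I Q =ᵐ[boundaryMeasure n] J ⁻¹' Q := by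
  filter_upwards [hJ] with ζ hζ
  refine propext ⟨?_, fun h => ⟨J ζ, h, hζ⟩⟩
  rintro ⟨q, hq, h⟩
  have : J ζ = q := Circle.coe_injective (hζ.symm.trans h)
  exact mem_preimage.2 (this ▸ hq)

theorem MemLargeModel.integral_comp_mul_self [∀ j, NeZero (n j)] (hI : IsInner I)
    (hf : MemLargeModel I f) {J : Boundary n → Circle} (hJm : Measurable J)
    (hJ : ∀ᵐ ζ ∂boundaryMeasure n, radialLimit I ζ = J ζ) {Φ : Circle → ℂ}
    (hΦ : Integrable Φ circleMeasure) :
    Integrable (fun ζ => Φ (J ζ) * (radialLimit f ζ * conj (radialLimit f ζ)))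
      (boundaryMeasure n) ∧
    ∫ ζ, Φ (J ζ) * (radialLimit f ζ * conj (radialLimit f ζ)) ∂boundaryMeasure n =
      (∫ w, Φ w ∂circleMeasure) * (hardyNormSq f).toReal := by
  have hd := hf.1.aemeasurable_enorm_sq
  have hfin : ∀ᵐ ζ ∂boundaryMeasure n, ‖radialLimit f ζ‖ₑ ^ 2 < ⊤ :=
    Eventually.of_forall fun ζ => by finiteness
  have hmap := hf.map_withDensity hI hJm hJ
  have h1 : Integrable Φ (((boundaryMeasure n).withDensity
      fun ζ => ‖radialLimit f ζ‖ₑ ^ 2).map J) := by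
    rw [hmap]; exact hΦ.smul_measure hf.1.2.ne
  have h2 : (fun ζ => Φ (J ζ) * (radialLimit f ζ * conj (radialLimit f ζ))) =
      fun ζ => (‖radialLimit f ζ‖ₑ ^ 2).toReal • Φ (J ζ) := by
    funext ζ
    rw [Complex.mul_conj, Complex.normSq_eq_norm_sq, mul_comm]
    simp
  rw [h2]
  constructor
  · exact (integrable_withDensity_iff_integrable_smul₀' hd hfin).1 (h1.comp_measurable hJm)
  · rw [← integral_withDensity_eq_integral_toReal_smul₀ hd hfin, ← integral_map hJm.aemeasurable
      h1.aestronglyMeasurable, hmap, integral_smul_measure, Complex.real_smul, mul_comm]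

/-- Polarization of `MemLargeModel.integral_comp_mul_self`. -/
theorem MemLargeModel.integral_comp_mul [∀ j, NeZero (n j)] (hI : IsInner I)
    (hf : MemLargeModel I f) (hg : MemLargeModel I g) {J : Boundary n → Circle}
    (hJm : Measurable J) (hJ : ∀ᵐ ζ ∂boundaryMeasure n, radialLimit I ζ = J ζ) {Φ : Circle → ℂ}
    (hΦ : Integrable Φ circleMeasure) :
    Integrable (fun ζ => Φ (J ζ) * (radialLimit f ζ * conj (radialLimit g ζ)))
      (boundaryMeasure n) ∧
    ∫ ζ, Φ (J ζ) * (radialLimit f ζ * conj (radialLimit g ζ)) ∂boundaryMeasure n =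
      (∫ w, Φ w ∂circleMeasure) * hardyInner f g := by
  set p : ℕ → Space n → ℂ := fun j z => f z + Complex.I ^ j * g z
  have hpm : ∀ j, MemLargeModel I (p j) := fun j => hf.add_const_mul hI hg _
  -- Since `∑ iʲ = ∑ i²ʲ = 0` over `j < 4`, one has `4 f ḡ = ∑ iʲ |f + iʲ g|²`.
  have hpol : ∀ Ψ : Circle → ℂ,
      (fun ζ => Ψ (J ζ) * (radialLimit f ζ * conj (radialLimit g ζ))) =ᵐ[boundaryMeasure n]
      fun ζ => ∑ j ∈ Finset.range 4, Complex.I ^ j / 4 *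
        (Ψ (J ζ) * (radialLimit (p j) ζ * conj (radialLimit (p j) ζ))) := by
    intro Ψ
    have h := ae_all_iff.2 fun j : ℕ => radialLimit_add_const_mul hf.1 hg.1 (Complex.I ^ j)
    filter_upwards [h] with ζ hζ
    have hζ' : ∀ j, radialLimit (p j) ζ = radialLimit f ζ + Complex.I ^ j * radialLimit g ζ := hζ
    simp only [hζ', Finset.sum_range_succ, Finset.range_zero, Finset.sum_empty, map_add, map_mul,
      map_pow, Complex.conj_I, pow_succ, pow_zero]
    have hI3 : Complex.I ^ 3 = -Complex.I := by rw [pow_succ, Complex.I_sq]; ring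
    have hI6 : Complex.I ^ 6 = -1 := by rw [pow_succ, pow_succ, Complex.I_pow_four, one_mul,
      Complex.I_mul_I]
    have hI9 : Complex.I ^ 9 = Complex.I := by
      rw [show 9 = 4 + 4 + 1 from rfl, pow_succ, pow_add, Complex.I_pow_four]; ring
    ring_nf
    simp only [Complex.I_sq, hI3, Complex.I_pow_four]
    ring_nf
    simp only [hI6, hI9]
    ring
  have hsum : ∀ Ψ : Circle → ℂ, Integrable Ψ circleMeasure →
      Integrable (fun ζ => Ψ (J ζ) * (radialLimit f ζ * conj (radialLimit g ζ)))
        (boundaryMeasure n) ∧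
      ∫ ζ, Ψ (J ζ) * (radialLimit f ζ * conj (radialLimit g ζ)) ∂boundaryMeasure n =
        (∫ w, Ψ w ∂circleMeasure) *
          ∑ j ∈ Finset.range 4, Complex.I ^ j / 4 * (hardyNormSq (p j)).toReal := by
    intro Ψ hΨ
    have hint : ∀ j ∈ Finset.range 4, Integrable (fun ζ => Complex.I ^ j / 4 *
        (Ψ (J ζ) * (radialLimit (p j) ζ * conj (radialLimit (p j) ζ)))) (boundaryMeasure n) :=
      fun j _ => ((hpm j).integral_comp_mul_self hI hJm hJ hΨ).1.const_mul _
    refine ⟨(integrable_finsetSum _ hint).congr (hpol Ψ).symm, ?_⟩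
    rw [integral_congr_ae (hpol Ψ), integral_finsetSum _ hint, Finset.mul_sum]
    refine Finset.sum_congr rfl fun j _ => ?_
    rw [integral_const_mul, ((hpm j).integral_comp_mul_self hI hJm hJ hΨ).2]
    ring
  -- The constant function `1` identifies the polarized sum of norms as the inner product.
  have hone := (hsum (fun _ => 1) (integrable_const _)).2
  simp only [one_mul, integral_const, probReal_univ, one_smul] at hone
  rw [hardyInner, hone]
  exact hsum Φ hΦ

end HardyProduct

end

theorem mainTheorem2 (k : ℕ) (hk : 1 ≤ k) (n : Fin k → ℕ) (hn : ∀ j, 1 ≤ n j)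
    (I : HardyProduct.Space n → ℂ) (hI : HardyProduct.IsInner I) :
    (∀ Φ : Circle → ℂ, Integrable Φ HardyProduct.circleMeasure →
      AEStronglyMeasurable (HardyProduct.boundaryComp Φ I) (HardyProduct.boundaryMeasure n) ∧
      ∀ f g : HardyProduct.Space n → ℂ,
        HardyProduct.MemLargeModel I f → HardyProduct.MemLargeModel I g →
        Integrable (fun ζ => HardyProduct.boundaryComp Φ I ζ * HardyProduct.radialLimit f ζ *
          conj (HardyProduct.radialLimit g ζ)) (HardyProduct.boundaryMeasure n) ∧
        ∫ ζ, HardyProduct.boundaryComp Φ I ζ * HardyProduct.radialLimit f ζ *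
            conj (HardyProduct.radialLimit g ζ) ∂(HardyProduct.boundaryMeasure n) =
          (∫ w, Φ w ∂HardyProduct.circleMeasure) * HardyProduct.hardyInner f g) ∧
    (∀ Q : Set Circle, NullMeasurableSet Q HardyProduct.circleMeasure →
      NullMeasurableSet (HardyProduct.boundaryPreimage I Q) (HardyProduct.boundaryMeasure n) ∧
      ∀ f : HardyProduct.Space n → ℂ, HardyProduct.MemLargeModel I f →
        ∫⁻ ζ in HardyProduct.boundaryPreimage I Q, ‖HardyProduct.radialLimit f ζ‖ₑ ^ 2
            ∂(HardyProduct.boundaryMeasure n) =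
          HardyProduct.circleMeasure Q * HardyProduct.hardyNormSq f) := by
  have : ∀ j, NeZero (n j) := fun j => ⟨by have := hn j; omega⟩
  obtain ⟨J, hJm, hJ⟩ := hI.exists_measurable_circle
  have hqmp := hI.quasiMeasurePreserving hJm hJ
  constructor
  · intro Φ hΦ
    have hcomp := HardyProduct.boundaryComp_ae_eq hJ Φ
    refine ⟨(hΦ.1.comp_quasiMeasurePreserving hqmp).congr hcomp.symm, fun f g hf hg => ?_⟩
    have hae : (fun ζ => HardyProduct.boundaryComp Φ I ζ * HardyProduct.radialLimit f ζ *
        conj (HardyProduct.radialLimit g ζ)) =ᵐ[HardyProduct.boundaryMeasure n] fun ζ =>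
        Φ (J ζ) * (HardyProduct.radialLimit f ζ * conj (HardyProduct.radialLimit g ζ)) := by
      filter_upwards [hcomp] with ζ hζ
      rw [hζ, mul_assoc]
    have h := hf.integral_comp_mul hI hg hJm hJ hΦ
    exact ⟨h.1.congr hae.symm, (integral_congr_ae hae).trans h.2⟩
  · intro Q hQ
    have hpre := HardyProduct.boundaryPreimage_ae_eq hJ Q
    have hnull : NullMeasurableSet (J ⁻¹' Q) (HardyProduct.boundaryMeasure n) := hQ.preimage hqmp
    refine ⟨hnull.congr hpre.symm, fun f hf => ?_⟩
    have hmap := hf.map_withDensity hI hJm hJ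
    have hQ' : NullMeasurableSet Q (((HardyProduct.boundaryMeasure n).withDensity
        fun ζ => ‖HardyProduct.radialLimit f ζ‖ₑ ^ 2).map J) := by
      rw [hmap]; exact hQ.mono_ac Measure.smul_absolutelyContinuous
    rw [setLIntegral_congr hpre, ← withDensity_apply₀ _ hnull,
      ← Measure.map_apply₀ hJm.aemeasurable hQ', hmap, Measure.smul_apply, smul_eq_mul, mul_comm]
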